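/- All multicategories are small and symmetric: a multicategory $M$ has a set of objects, for each $k\ge 0$ a set of $k$-morphisms $(a_1,\dots,a_k)\to b$, a right action $\sigma^*:M_k(a_1,\dots,a_k;b)\to M_k(a_{\sigma(1)},\dots,a_{\sigma(k)};b)$ of $\Sigma_k$, units $1_a:(a)\to a$, and a composition $\Gamma$, subject to the associativity, unit and equivariance identities of an operad. Let $\mathbf{Mult}$ be the category of small multicategories and multifunctors (structure preserving maps). For multicategories $M,N$, let $\mathbf{Hom}(M,N)$ be the multicategory whose objects are the multifunctors $M\to N$ and whose $k$-morphisms $(f_1,\dots,f_k)\to g$ are the $k$-natural transformations: families of $k$-morphisms $\xi_a:(f_1a,\dots,f_ka)\to ga$ of $N$, one for each object $a$ of $M$, such that for every $\phi:(a_1,\dots,a_m)\to b$ in $M$ the composite of $g\phi$ with $(\xi_{a_i})_{i}$ equals the composite of $\xi_b$ with $(f_j\phi)_j$, up to the permutation that shuffles $m$ blocks of $k$ entries into $k$ blocks of $m$ entries. Units, composition and symmetric group actions are those of $N$, taken componentwise. A bilinear map $f:(M,N)\to P$ consists of objects $f(a,b)$ of $P$, and of morphisms $f(\phi,b):(f(a_1,b),\dots,f(a_m,b))\to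 f(a',b)$ and $f(a,\psi):(f(a,b_1),\dots,f(a,b_n))\to f(a,b')$ for $\phi:(a_1,\dots,a_m)\to a'$ in $M$ and $\psi:(b_1,\dots,b_n)\to b'$ in $N$, such that $f(-,b)$ and $f(a,-)$ are multifunctors and, for all $\phi$ and $\psi$, the composite of $f(a',\psi)$ with $(f(\phi,b_j))_j$ equals the composite of $f(\phi,b')$ with $(f(a_i,\psi))_i$ up to the corresponding shuffle. Let $M\otimes N$ be the multicategory with object set $\mathrm{Ob}\,M\times\mathrm{Ob}\,N$ whose morphisms are generated by symbols $\phi\otimes b$ and $a\otimes\psi$, subject only to the relations that make $(M,N)\to M\otimes N$ bilinear. Let $I$ be the multicategory with one object and only the identity morphism on that object. **Theorem.** The tensor product $\otimes$ and the internal Hom make $\mathbf{Mult}$ into a symmetric monoidal closed category. In detail: 1. $(M,N)\to M\otimes N$ is a universal bilinear map: every bilinear map $(M,N)\to P$ factors through it by a unique multifunctor $M\otimes N\to P$. 2. There are isomorphisms $(M\otimes N)\otimes P\cong M\otimes(N\otimes P)$, $I\otimes M\cong M$, $M\otimes I\cong M$ and $M\otimes N\cong N\otimes M$, given on objects and on generating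 morphisms by $(x\otimes y)\otimes z\mapsto x\otimes(y\otimes z)$, $*\otimes x\mapsto x$, $x\otimes *\mapsto x$ and $x\otimes y\mapsto y\otimes x$, which make $(\mathbf{Mult},\otimes,I)$ a symmetric monoidal category. 3. For each $N$, the functor $\mathbf{Hom}(N,-)$ is right adjoint to $-\otimes N$, by the bijection that sends $F:M\otimes N\to P$ to the multifunctor $M\to\mathbf{Hom}(N,P)$, $a\mapsto F(a\otimes -)$. Thus the symmetric monoidal category is closed with internal Hom $\mathbf{Hom}$. 4. This bijection is the object part of an isomorphism of multicategories $\mathbf{Hom}(M\otimes N,P)\cong\mathbf{Hom}(M,\mathbf{Hom}(N,P))$, given on $k$-natural transformations by $\xi\mapsto\bigl((\xi_{(a,b)})_b\bigr)_a$ and natural in $M$, $N$ and $P$. -/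

import Mathlib

open CategoryTheory

universe u

namespace EM

/-- The concatenation `⟨⟨a_{ij}⟩_{j=1}^{k_i}⟩_{i=1}^n` of `n` strings; the pairs `(i, j)` are
listed in lexicographic order by `finSigmaFinEquiv`. -/
abbrev concat {α : Type*} {n : ℕ} {k : Fin n → ℕ} (a : ∀ i, Fin (k i) → α) :
    Fin (∑ i, k i) → α :=
  fun p => a (finSigmaFinEquiv.symm p).1 (finSigmaFinEquiv.symm p).2

theorem concat_apply {α : Type*} {n : ℕ} {k : Fin n → ℕ} (a : ∀ i, Fin (k i) → α)
    (x : (i : Fin n) × Fin (k i)) : concat a (finSigmaFinEquiv x) = a x.1 x.2 := by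
  change a (finSigmaFinEquiv.symm _).1 (finSigmaFinEquiv.symm _).2 = _
  rw [Equiv.symm_apply_apply]

/-- A bijection of doubly indexed families, read as a bijection of the concatenated strings. -/
def reindex {n n' : ℕ} {k : Fin n → ℕ} {k' : Fin n' → ℕ}
    (e : ((i : Fin n) × Fin (k i)) ≃ ((i : Fin n') × Fin (k' i))) :
    Fin (∑ i, k i) ≃ Fin (∑ i, k' i) :=
  finSigmaFinEquiv.symm.trans (e.trans finSigmaFinEquiv)

theorem concat_reindex {α : Type*} {n n' : ℕ} {k : Fin n → ℕ} {k' : Fin n' → ℕ}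
    {a : ∀ i, Fin (k i) → α} {a' : ∀ i, Fin (k' i) → α}
    (e : ((i : Fin n) × Fin (k i)) ≃ ((i : Fin n') × Fin (k' i)))
    (h : ∀ x, a x.1 x.2 = a' (e x).1 (e x).2) (p : Fin (∑ i, k i)) :
    concat a p = concat a' (reindex e p) :=
  (h (finSigmaFinEquiv.symm p)).trans (concat_apply a' (e (finSigmaFinEquiv.symm p))).symm

/-- The bijection that reverses the priority of the indices: it shuffles `m` blocks of `k` entries
each into `k` blocks of `m` entries each. -/
def shuffle (m k : ℕ) : Fin (∑ _i : Fin m, k) ≃ Fin (∑ _j : Fin k, m) :=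
  reindex (k := fun _ => k) (k' := fun _ => m)
    ⟨fun x => ⟨x.2, x.1⟩, fun x => ⟨x.2, x.1⟩, fun _ => rfl, fun _ => rfl⟩

theorem concat_shuffle {α : Type*} {m k : ℕ} (a : Fin m → Fin k → α) (p : Fin (∑ _i : Fin m, k)) :
    concat a p = concat (fun j i => a i j) (shuffle m k p) :=
  concat_reindex _ (fun _ => rfl) p

/-- The block permutation `σ⟨k_1, …, k_n⟩`. -/
def blockPerm {n : ℕ} (σ : Equiv.Perm (Fin n)) (k : Fin n → ℕ) :
    Fin (∑ j, k (σ j)) ≃ Fin (∑ i, k i) :=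
  reindex (Equiv.sigmaCongrLeft (β := fun i => Fin (k i)) σ)

/-- The block sum `τ_1 ⊕ ⋯ ⊕ τ_n`. -/
def blockSum {n : ℕ} {k : Fin n → ℕ} (τ : ∀ i, Equiv.Perm (Fin (k i))) :
    Equiv.Perm (Fin (∑ i, k i)) :=
  reindex (Equiv.sigmaCongrRight τ)

/-- The order preserving identification of the two ways of concatenating a triply indexed family. -/
def assocEquiv {n : ℕ} {k : Fin n → ℕ} (l : ∀ i, Fin (k i) → ℕ) :
    Fin (∑ p, concat l p) ≃ Fin (∑ i, ∑ j, l i j) :=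
  finSigmaFinEquiv.symm.trans
    ((Equiv.sigmaCongrLeft (β := fun x : (i : Fin n) × Fin (k i) => Fin (l x.1 x.2))
        finSigmaFinEquiv.symm).trans
      ((Equiv.sigmaAssoc (fun i (j : Fin (k i)) => Fin (l i j))).trans
        ((Equiv.sigmaCongrRight fun _ => finSigmaFinEquiv).trans finSigmaFinEquiv)))

theorem concat_assoc {α : Type*} {n : ℕ} {k : Fin n → ℕ} {l : ∀ i, Fin (k i) → ℕ}
    (a : ∀ i (j : Fin (k i)), Fin (l i j) → α) (q : Fin (∑ p, concat l p)) :
    concat (k := concat l)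
        (fun p => a (finSigmaFinEquiv.symm p).1 (finSigmaFinEquiv.symm p).2) q =
      concat (fun i => concat (a i)) (assocEquiv l q) :=
  ((concat_apply (fun i => concat (a i)) ⟨_, _⟩).trans (concat_apply (a _) ⟨_, _⟩)).symm

/-- One block of `k` entries. -/
def oneBlock (k : ℕ) : Fin (∑ _i : Fin 1, k) ≃ Fin k :=
  (finSigmaFinEquiv (n := fun _ : Fin 1 => k)).symm.trans
    ((Equiv.sigmaEquivProd _ _).trans (Equiv.uniqueProd _ _))

/-- `n` blocks of one entry each. -/
def blocksOfOne (n : ℕ) : Fin (∑ _i : Fin n, 1) ≃ Fin n :=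
  (finSigmaFinEquiv (n := fun _ : Fin n => 1)).symm.trans
    ((Equiv.sigmaEquivProd _ _).trans (Equiv.prodUnique _ _))

/-- The data of a (symmetric, small) multicategory: objects, `k`-morphisms `(a_1, …, a_k) → b`,
the action `σ^* : M(a_1, …, a_k; b) → M(a_{σ(1)}, …, a_{σ(k)}; b)`, units and composition. -/
structure MultiData where
  Ob : Type u
  Hom : {k : ℕ} → (Fin k → Ob) → Ob → Type u
  perm : ∀ {k : ℕ} {a : Fin k → Ob} {b : Ob} (σ : Equiv.Perm (Fin k)),
    Hom a b → Hom (fun i => a (σ i)) b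
  one : ∀ a : Ob, Hom (fun _ : Fin 1 => a) a
  comp : ∀ {n : ℕ} {k : Fin n → ℕ} {a : ∀ i, Fin (k i) → Ob} {b : Fin n → Ob} {c : Ob},
    Hom b c → (∀ i, Hom (a i) (b i)) → Hom (concat a) c

namespace MultiData

variable (D : MultiData.{u})

/-- The action of a bijection `e : Fin k ≃ Fin l`. Since `k = l`, this is the action of a
permutation, transported along equalities of strings of objects. -/
def relabel {k l : ℕ} (e : Fin k ≃ Fin l) {a' : Fin k → D.Ob} {a : Fin l → D.Ob} {b : D.Ob}
    (h : ∀ i, a' i = a (e i)) (f : D.Hom a b) : D.Hom a' b := by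
  obtain rfl : k = l := Fin.equiv_iff_eq.mp ⟨e⟩
  exact cast (by rw [funext h]) (D.perm e f)

theorem relabel_rfl {k : ℕ} (σ : Equiv.Perm (Fin k)) {a : Fin k → D.Ob} {b : D.Ob}
    (f : D.Hom a b) : D.relabel σ (fun _ => rfl) f = D.perm σ f := rfl

end MultiData

/-- A (symmetric) multicategory whose objects and whose `k`-morphisms form sets. The identities are
those of an operad. Associativity and the unit laws hold strictly; `relabel` there only identifies
equal strings along order preserving bijections. -/
structure Multicategory extends MultiData.{u} where
  perm_one : ∀ {k : ℕ} {a : Fin k → Ob} {b : Ob} (f : Hom a b),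
    perm (Equiv.refl (Fin k)) f = f
  perm_perm : ∀ {k : ℕ} {a : Fin k → Ob} {b : Ob} (σ τ : Equiv.Perm (Fin k)) (f : Hom a b),
    perm σ (perm τ f) = perm (σ.trans τ) f
  one_comp : ∀ {k : ℕ} {a : Fin k → Ob} {b : Ob} (f : Hom a b),
    comp (one b) (fun _ : Fin 1 => f) =
      toMultiData.relabel (oneBlock k) (fun _ => rfl) f
  comp_one : ∀ {n : ℕ} {a : Fin n → Ob} {b : Ob} (f : Hom a b),
    comp f (fun i => one (a i)) = toMultiData.relabel (blocksOfOne n) (fun _ => rfl) f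
  comp_comp : ∀ {n : ℕ} {k : Fin n → ℕ} {l : ∀ i, Fin (k i) → ℕ}
    {a : ∀ i (j : Fin (k i)), Fin (l i j) → Ob} {b : ∀ i, Fin (k i) → Ob} {c : Fin n → Ob} {d : Ob}
    (f : Hom c d) (g : ∀ i, Hom (b i) (c i)) (h : ∀ i j, Hom (a i j) (b i j)),
    comp (k := concat l) (comp f g)
        (fun p => h (finSigmaFinEquiv.symm p).1 (finSigmaFinEquiv.symm p).2) =
      toMultiData.relabel (assocEquiv l) (concat_assoc a)
        (comp f (fun i => comp (g i) (h i)))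
  perm_comp : ∀ {n : ℕ} {k : Fin n → ℕ} {a : ∀ i, Fin (k i) → Ob} {b : Fin n → Ob} {c : Ob}
    (σ : Equiv.Perm (Fin n)) (f : Hom b c) (g : ∀ i, Hom (a i) (b i)),
    comp (perm σ f) (fun j => g (σ j)) =
      toMultiData.relabel (blockPerm σ k) (concat_reindex _ fun _ => rfl) (comp f g)
  comp_perm : ∀ {n : ℕ} {k : Fin n → ℕ} {a : ∀ i, Fin (k i) → Ob} {b : Fin n → Ob} {c : Ob}
    (f : Hom b c) (τ : ∀ i, Equiv.Perm (Fin (k i))) (g : ∀ i, Hom (a i) (b i)),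
    comp f (fun i => perm (τ i) (g i)) =
      toMultiData.relabel (blockSum τ) (concat_reindex _ fun _ => rfl) (comp f g)

/-- A multifunctor: a structure preserving map of multicategories. -/
@[ext]
structure Multifunctor (M N : Multicategory.{u}) where
  obj : M.Ob → N.Ob
  map : ∀ {k : ℕ} {a : Fin k → M.Ob} {b : M.Ob}, M.Hom a b → N.Hom (fun i => obj (a i)) (obj b)
  map_perm : ∀ {k : ℕ} {a : Fin k → M.Ob} {b : M.Ob} (σ : Equiv.Perm (Fin k)) (f : M.Hom a b),
    map (M.perm σ f) = N.perm σ (map f)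
  map_one : ∀ a : M.Ob, map (M.one a) = N.one (obj a)
  map_comp : ∀ {n : ℕ} {k : Fin n → ℕ} {a : ∀ i, Fin (k i) → M.Ob} {b : Fin n → M.Ob} {c : M.Ob}
    (f : M.Hom b c) (g : ∀ i, M.Hom (a i) (b i)),
    map (M.comp f g) = N.comp (map f) (fun i => map (g i))

/-- The category `Mult` of small multicategories and multifunctors. -/
instance : Category.{u} Multicategory.{u} where
  Hom M N := Multifunctor M N
  id M :=
    { obj := fun a => a
      map := fun f => f
      map_perm := fun _ _ => rfl
      map_one := fun _ => rfl
      map_comp := fun _ _ => rfl }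
  comp F G :=
    { obj := fun a => G.obj (F.obj a)
      map := fun f => G.map (F.map f)
      map_perm := fun σ f => by rw [F.map_perm, G.map_perm]
      map_one := fun a => by rw [F.map_one, G.map_one]
      map_comp := fun f g => by rw [F.map_comp, G.map_comp] }

/-- A multifunctor as a morphism of `Mult`. -/
abbrev Multifunctor.toHom {M N : Multicategory.{u}} (F : Multifunctor M N) : M ⟶ N := F

namespace Multicategory

variable (M : Multicategory.{u})

theorem relabel_congr {k l : ℕ} {e e' : Fin k ≃ Fin l} (he : e = e') {a' : Fin k → M.Ob}
    {a : Fin l → M.Ob} {b : M.Ob} (h : ∀ i, a' i = a (e i)) (h' : ∀ i, a' i = a (e' i))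
    (f : M.Hom a b) : M.relabel e h f = M.relabel e' h' f := by
  subst he; rfl

theorem relabel_relabel {k l m : ℕ} (e : Fin k ≃ Fin l) (e' : Fin l ≃ Fin m)
    {a'' : Fin k → M.Ob} {a' : Fin l → M.Ob} {a : Fin m → M.Ob} {b : M.Ob}
    (h : ∀ i, a'' i = a' (e i)) (h' : ∀ i, a' i = a (e' i)) (f : M.Hom a b) :
    M.relabel e h (M.relabel e' h' f) =
      M.relabel (e.trans e') (fun i => (h i).trans (h' (e i))) f := by
  obtain rfl : k = l := Fin.equiv_iff_eq.mp ⟨e⟩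
  obtain rfl : k = m := Fin.equiv_iff_eq.mp ⟨e'⟩
  obtain rfl : a' = fun i => a (e' i) := funext h'
  obtain rfl : a'' = fun i => a (e' (e i)) := funext h
  exact M.perm_perm e e' f

theorem relabel_refl {k : ℕ} {a : Fin k → M.Ob} {b : M.Ob} (f : M.Hom a b) :
    M.relabel (Equiv.refl (Fin k)) (fun _ => rfl) f = f := M.perm_one f

theorem comp_relabel {n : ℕ} {k k' : Fin n → ℕ} {a : ∀ i, Fin (k i) → M.Ob}
    {a' : ∀ i, Fin (k' i) → M.Ob} {b : Fin n → M.Ob} {c : M.Ob} (f : M.Hom b c)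
    (τ : ∀ i, Fin (k' i) ≃ Fin (k i)) (h : ∀ i j, a' i j = a i (τ i j))
    (g : ∀ i, M.Hom (a i) (b i)) :
    M.comp f (fun i => M.relabel (τ i) (h i) (g i)) =
      M.relabel (reindex (Equiv.sigmaCongrRight τ)) (concat_reindex _ fun x => h x.1 x.2)
        (M.comp f g) := by
  obtain rfl : k' = k := funext fun i => Fin.equiv_iff_eq.mp ⟨τ i⟩
  obtain rfl : a' = fun i j => a i (τ i j) := funext fun i => funext (h i)
  exact M.comp_perm f τ g

/-- The bijection of concatenated strings that permutes blocks indexed through a set `J`. -/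
def blockEquiv {J : Type*} (κ : J → ℕ) {n n' : ℕ} {v : Fin n → J} {w : Fin n' → J}
    (e : Fin n ≃ Fin n') (h : ∀ i, v i = w (e i)) :
    Fin (∑ i, κ (v i)) ≃ Fin (∑ i, κ (w i)) :=
  reindex ((Equiv.sigmaCongrRight fun i => finCongr (congrArg κ (h i))).trans
    (Equiv.sigmaCongrLeft (β := fun i => Fin (κ (w i))) e))

theorem concat_blockEquiv {α : Type*} {J : Type*} {κ : J → ℕ} (α' : ∀ j, Fin (κ j) → α)
    {n n' : ℕ} {v : Fin n → J} {w : Fin n' → J}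
    (e : Fin n ≃ Fin n') (h : ∀ i, v i = w (e i)) (p : Fin (∑ i, κ (v i))) :
    concat (fun i => α' (v i)) p = concat (fun i => α' (w i)) (blockEquiv κ e h p) := by
  obtain rfl : v = fun i => w (e i) := funext h
  exact concat_reindex _ (fun _ => rfl) p

theorem relabel_comp {J : Type*} {κ : J → ℕ} {α' : ∀ j, Fin (κ j) → M.Ob} {β : J → M.Ob}
    (Z : ∀ j, M.Hom (α' j) (β j)) {n n' : ℕ} {v : Fin n → J} {w : Fin n' → J}
    (e : Fin n ≃ Fin n') (h : ∀ i, v i = w (e i)) {c : M.Ob} (f : M.Hom (fun i => β (w i)) c) :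
    M.comp (M.relabel e (fun i => congrArg β (h i)) f) (fun i => Z (v i)) =
      M.relabel (blockEquiv κ e h) (concat_blockEquiv α' e h) (M.comp f (fun i => Z (w i))) := by
  obtain rfl : v = fun i => w (e i) := funext h
  obtain rfl : n = n' := Fin.equiv_iff_eq.mp ⟨e⟩
  refine (M.perm_comp e f (fun i => Z (w i))).trans (M.relabel_congr ?_ _ _ _)
  rfl

theorem relabel_injective {k l : ℕ} (e : Fin k ≃ Fin l) {a' : Fin k → M.Ob} {a : Fin l → M.Ob}
    {b : M.Ob} (h : ∀ i, a' i = a (e i)) {f g : M.Hom a b}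
    (hfg : M.relabel e h f = M.relabel e h g) : f = g := by
  have key : ∀ f : M.Hom a b,
      M.relabel e.symm (fun i => by rw [h, e.apply_symm_apply]) (M.relabel e h f) = f := fun f =>
    (M.relabel_relabel _ _ _ _ _).trans
      ((M.relabel_congr e.symm_trans_self _ _ _).trans (M.relabel_refl f))
  rw [← key f, hfg, key g]

end Multicategory

theorem assocEquiv_eq {n : ℕ} {k : Fin n → ℕ} (l : ∀ i, Fin (k i) → ℕ) (q : Fin (∑ i, k i))
    (t' : Fin (concat l q)) (x : (i : Fin n) × Fin (k i)) (hx : finSigmaFinEquiv.symm q = x)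
    (t : Fin (l x.1 x.2)) (ht : (t' : ℕ) = t) :
    assocEquiv l (finSigmaFinEquiv ⟨q, t'⟩) =
      finSigmaFinEquiv ⟨x.1, finSigmaFinEquiv ⟨x.2, t⟩⟩ := by
  subst hx
  obtain rfl : t' = t := Fin.ext ht
  simp only [assocEquiv, Equiv.trans_apply, Equiv.symm_apply_apply]
  rfl

theorem assocEquiv_const {n : ℕ} {k : Fin n → ℕ} (m : ℕ) (x : (i : Fin n) × Fin (k i)) (t : Fin m) :
    assocEquiv (fun i (_ : Fin (k i)) => m)
        (finSigmaFinEquiv (n := concat fun i (_ : Fin (k i)) => m) ⟨finSigmaFinEquiv x, t⟩) =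
      finSigmaFinEquiv ⟨x.1, finSigmaFinEquiv (n := fun _ : Fin (k x.1) => m) ⟨x.2, t⟩⟩ := by
  have h := assocEquiv_eq (fun i (_ : Fin (k i)) => m) (finSigmaFinEquiv x) t x
    (Equiv.symm_apply_apply _ _) t rfl
  exact h

theorem reindex_apply {n n' : ℕ} {k : Fin n → ℕ} {k' : Fin n' → ℕ}
    (e : ((i : Fin n) × Fin (k i)) ≃ ((i : Fin n') × Fin (k' i))) (x : (i : Fin n) × Fin (k i)) :
    reindex e (finSigmaFinEquiv x) = finSigmaFinEquiv (e x) := by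
  simp [reindex]

theorem Multifunctor.map_relabel {M N : Multicategory.{u}} (F : Multifunctor M N) {k l : ℕ}
    (e : Fin k ≃ Fin l) {a' : Fin k → M.Ob} {a : Fin l → M.Ob} {b : M.Ob}
    (h : ∀ i, a' i = a (e i)) (f : M.Hom a b) :
    F.map (M.relabel e h f) = N.relabel e (fun i => congrArg F.obj (h i)) (F.map f) := by
  obtain rfl : k = l := Fin.equiv_iff_eq.mp ⟨e⟩
  obtain rfl : a' = fun i => a (e i) := funext h
  exact F.map_perm e f

/-- A `k`-natural transformation `(f_1, …, f_k) → g` of multifunctors. -/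
@[ext]
structure KNatTrans {M N : Multicategory.{u}} {k : ℕ} (f : Fin k → Multifunctor M N)
    (g : Multifunctor M N) where
  app : ∀ a : M.Ob, N.Hom (fun j => (f j).obj a) (g.obj a)
  naturality : ∀ {m : ℕ} {a : Fin m → M.Ob} {b : M.Ob} (φ : M.Hom a b),
    N.comp (g.map φ) (fun i => app (a i)) =
      N.relabel (shuffle m k) (concat_shuffle fun i j => (f j).obj (a i))
        (N.comp (app b) (fun j => (f j).map φ))

section InternalHom

variable {M N : Multicategory.{u}}

def homOne (f : Multifunctor M N) : KNatTrans (fun _ : Fin 1 => f) f where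
  app a := N.one (f.obj a)
  naturality {m a b} φ := by
    refine (N.comp_one (f.map φ)).trans (Eq.symm ?_)
    refine (congrArg (N.relabel _ _) (N.one_comp (f.map φ))).trans ?_
    refine (N.relabel_relabel _ _ _ _ _).trans (N.relabel_congr (Equiv.ext fun p => ?_) _ _ _)
    obtain ⟨x, rfl⟩ := (finSigmaFinEquiv (n := fun _ : Fin m => 1)).surjective p
    simp [blocksOfOne, oneBlock, shuffle, reindex]

def homPerm {k : ℕ} {f : Fin k → Multifunctor M N} {g : Multifunctor M N}
    (σ : Equiv.Perm (Fin k)) (ξ : KNatTrans f g) : KNatTrans (fun j => f (σ j)) g where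
  app a := N.perm σ (ξ.app a)
  naturality {m a b} φ := by
    refine (N.comp_perm (g.map φ) (fun _ => σ) (fun i => ξ.app (a i))).trans ?_
    refine (congrArg (N.relabel _ _) (ξ.naturality φ)).trans ?_
    refine (N.relabel_relabel _ _ _ _ _).trans (Eq.symm ?_)
    refine (congrArg (N.relabel _ _) (N.perm_comp σ (ξ.app b) (fun j => (f j).map φ))).trans ?_
    refine (N.relabel_relabel _ _ _ _ _).trans (N.relabel_congr (Equiv.ext fun p => ?_) _ _ _)
    obtain ⟨x, rfl⟩ := (finSigmaFinEquiv (n := fun _ : Fin m => k)).surjective p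
    simp [blockSum, blockPerm, shuffle, reindex, Equiv.sigmaCongrLeft]

def homComp {n : ℕ} {k : Fin n → ℕ} {e : ∀ i, Fin (k i) → Multifunctor M N}
    {f : Fin n → Multifunctor M N} {g : Multifunctor M N} (ξ : KNatTrans f g)
    (ζ : ∀ i, KNatTrans (e i) (f i)) : KNatTrans (concat e) g where
  app a := N.comp (ξ.app a) (fun i => (ζ i).app a)
  naturality {m a b} φ := by
    have h1 := N.comp_comp (g.map φ) (fun i => ξ.app (a i)) (fun s i => (ζ i).app (a s))
    have h2 := congrArg (fun F => N.comp (k := concat fun _ i => k i) F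
      (fun p => (ζ (finSigmaFinEquiv.symm p).2).app (a (finSigmaFinEquiv.symm p).1)))
      (ξ.naturality φ)
    have h3 := N.relabel_comp (J := Fin m × Fin n) (κ := fun x => k x.2)
      (α' := fun x j => (e x.2 j).obj (a x.1)) (β := fun x => (f x.2).obj (a x.1))
      (fun x => (ζ x.2).app (a x.1))
      (v := fun p : Fin (∑ _i : Fin m, n) =>
        ((finSigmaFinEquiv.symm p).1, (finSigmaFinEquiv.symm p).2))
      (w := fun p : Fin (∑ _i : Fin n, m) =>
        ((finSigmaFinEquiv.symm p).2, (finSigmaFinEquiv.symm p).1))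
      (shuffle m n) (by
        intro p
        obtain ⟨x, rfl⟩ := (finSigmaFinEquiv (n := fun _ : Fin m => n)).surjective p
        simp [shuffle, reindex]) (N.comp (ξ.app b) (fun i => (f i).map φ))
    have h4 := N.comp_comp (ξ.app b) (fun i => (f i).map φ) (fun i s => (ζ i).app (a s))
    have h5 := congrArg (N.comp (ξ.app b)) (funext fun i => (ζ i).naturality φ)
    have h6 := N.comp_relabel (ξ.app b) (fun i => shuffle m (k i))
      (fun i => concat_shuffle fun s j => (e i j).obj (a s))
      (fun i => N.comp ((ζ i).app b) (fun j => (e i j).map φ))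
    have h7 := N.comp_comp (ξ.app b) (fun i => (ζ i).app b) (fun i j => (e i j).map φ)
    refine N.relabel_injective _ _ (h1.symm.trans (h2.trans (h3.trans ?_)))
    refine (congrArg (N.relabel _ _) (h4.trans (congrArg (N.relabel _ _)
      (h5.trans h6)))).trans (Eq.symm ?_)
    refine (congrArg (N.relabel _ _) (congrArg (N.relabel _ _) h7)).trans ?_
    refine (congrArg (N.relabel _ _) (N.relabel_relabel _ _ _ _ _)).trans
      ((N.relabel_relabel _ _ _ _ _).trans (Eq.symm ?_))
    refine (congrArg (N.relabel _ _) (N.relabel_relabel _ _ _ _ _)).trans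
      ((N.relabel_relabel _ _ _ _ _).trans (N.relabel_congr (Equiv.ext fun p => ?_) _ _ _))
    obtain ⟨⟨q, t⟩, rfl⟩ := finSigmaFinEquiv.surjective p
    obtain ⟨⟨s, i⟩, rfl⟩ := (finSigmaFinEquiv (n := fun _ : Fin m => n)).surjective q
    have hk : concat (fun (_ : Fin m) i => k i) (finSigmaFinEquiv ⟨s, i⟩) = k i := concat_apply _ _
    have hsh : shuffle m n (finSigmaFinEquiv ⟨s, i⟩) = finSigmaFinEquiv ⟨i, s⟩ := reindex_apply _ _
    have hq : (finSigmaFinEquiv (n := fun _ : Fin m => n)).symm (finSigmaFinEquiv ⟨s, i⟩) =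
        ⟨s, i⟩ := Equiv.symm_apply_apply _ _
    simp only [Equiv.trans_apply]
    refine Eq.trans (b := finSigmaFinEquiv (n := fun i => ∑ _j : Fin (k i), m)
      ⟨i, finSigmaFinEquiv (n := fun _ : Fin (k i) => m) ⟨Fin.cast hk t, s⟩⟩) ?_ (Eq.symm ?_)
    · refine (congrArg _ (congrArg _ (reindex_apply _ _))).trans ?_
      refine (congrArg _ (assocEquiv_eq _ _ _ ⟨i, s⟩ (by rw [Equiv.symm_apply_eq]; exact hsh)
        (Fin.cast hk t) rfl)).trans ?_
      refine (reindex_apply _ _).trans (congrArg finSigmaFinEquiv (Sigma.ext rfl (heq_of_eq ?_)))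
      exact reindex_apply _ _
    · have e1 : assocEquiv (fun (_ : Fin m) i => k i)
          (finSigmaFinEquiv ⟨finSigmaFinEquiv ⟨s, i⟩, t⟩) =
          finSigmaFinEquiv ⟨s, finSigmaFinEquiv ⟨i, Fin.cast hk t⟩⟩ :=
        assocEquiv_eq (k := fun _ : Fin m => n) (fun (_ : Fin m) i => k i)
          (finSigmaFinEquiv (n := fun _ : Fin m => n) ⟨s, i⟩) t ⟨s, i⟩ hq (Fin.cast hk t) rfl
      have e2 : shuffle m (∑ i, k i)
          (finSigmaFinEquiv ⟨s, finSigmaFinEquiv ⟨i, Fin.cast hk t⟩⟩) =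
          finSigmaFinEquiv ⟨finSigmaFinEquiv ⟨i, Fin.cast hk t⟩, s⟩ := reindex_apply _ _
      have e3 : assocEquiv (fun i (_ : Fin (k i)) => m)
          (finSigmaFinEquiv (n := concat fun i (_ : Fin (k i)) => m)
            ⟨finSigmaFinEquiv ⟨i, Fin.cast hk t⟩, s⟩) =
          finSigmaFinEquiv ⟨i, finSigmaFinEquiv ⟨Fin.cast hk t, s⟩⟩ :=
        assocEquiv_const m ⟨i, Fin.cast hk t⟩ s
      exact (congrArg (fun z => assocEquiv (fun i (_ : Fin (k i)) => m)
        (shuffle m (∑ i, k i) z)) e1).trans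
          ((congrArg (assocEquiv fun i (_ : Fin (k i)) => m) e2).trans e3)

end InternalHom

abbrev homData (M N : Multicategory.{u}) : MultiData.{u} where
  Ob := Multifunctor M N
  Hom f g := KNatTrans f g
  perm σ ξ := homPerm σ ξ
  one f := homOne f
  comp ξ ζ := homComp ξ ζ

theorem homData_relabel_app {M N : Multicategory.{u}} {k l : ℕ} (e : Fin k ≃ Fin l)
    {f' : Fin k → Multifunctor M N} {f : Fin l → Multifunctor M N} {g : Multifunctor M N}
    (h : ∀ i, f' i = f (e i)) (ξ : KNatTrans f g) (a : M.Ob) :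
    KNatTrans.app ((homData M N).relabel e h ξ) a =
      N.relabel e (fun i => congrArg (fun F => F.obj a) (h i)) (ξ.app a) := by
  obtain rfl : k = l := Fin.equiv_iff_eq.mp ⟨e⟩
  obtain rfl : f' = fun i => f (e i) := funext h
  rfl

/-- The internal Hom multicategory: multifunctors and `k`-natural transformations, with units,
composition and symmetric group actions induced from those of `N`. -/
abbrev ihomObj (M N : Multicategory.{u}) : Multicategory.{u} where
  toMultiData := homData M N
  perm_one ξ := KNatTrans.ext (funext fun a => N.perm_one (ξ.app a))
  perm_perm σ τ ξ := KNatTrans.ext (funext fun a => N.perm_perm σ τ (ξ.app a))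
  one_comp ξ := KNatTrans.ext (funext fun a => by
    refine (N.one_comp (ξ.app a)).trans (Eq.symm ?_)
    exact homData_relabel_app _ _ _ a)
  comp_one ξ := KNatTrans.ext (funext fun a => by
    refine (N.comp_one (ξ.app a)).trans (Eq.symm ?_)
    exact homData_relabel_app _ _ _ a)
  comp_comp ξ ζ θ := KNatTrans.ext (funext fun a => by
    refine (N.comp_comp (ξ.app a) (fun i => (ζ i).app a) (fun i j => (θ i j).app a)).trans
      (Eq.symm ?_)
    exact homData_relabel_app _ _ _ a)
  perm_comp σ ξ ζ := KNatTrans.ext (funext fun a => by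
    refine (N.perm_comp σ (ξ.app a) (fun i => (ζ i).app a)).trans (Eq.symm ?_)
    exact homData_relabel_app _ _ _ a)
  comp_perm ξ τ ζ := KNatTrans.ext (funext fun a => by
    refine (N.comp_perm (ξ.app a) τ (fun i => (ζ i).app a)).trans (Eq.symm ?_)
    exact homData_relabel_app _ _ _ a)

/-- A bilinear map `(M, N) → P`. -/
@[ext]
structure Bilin (M N P : Multicategory.{u}) where
  obj : M.Ob → N.Ob → P.Ob
  mapLeft : ∀ {m : ℕ} {a : Fin m → M.Ob} {a' : M.Ob} (_ : M.Hom a a') (b : N.Ob),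
    P.Hom (fun i => obj (a i) b) (obj a' b)
  mapRight : ∀ (a : M.Ob) {n : ℕ} {b : Fin n → N.Ob} {b' : N.Ob} (_ : N.Hom b b'),
    P.Hom (fun j => obj a (b j)) (obj a b')
  left_perm : ∀ {m : ℕ} {a : Fin m → M.Ob} {a' : M.Ob} (σ : Equiv.Perm (Fin m)) (φ : M.Hom a a')
    (b : N.Ob), mapLeft (M.perm σ φ) b = P.perm σ (mapLeft φ b)
  left_one : ∀ (a : M.Ob) (b : N.Ob), mapLeft (M.one a) b = P.one (obj a b)
  left_comp : ∀ {n : ℕ} {k : Fin n → ℕ} {a : ∀ i, Fin (k i) → M.Ob} {a' : Fin n → M.Ob}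
    {a'' : M.Ob} (φ : M.Hom a' a'') (φ' : ∀ i, M.Hom (a i) (a' i)) (b : N.Ob),
    mapLeft (M.comp φ φ') b = P.comp (mapLeft φ b) (fun i => mapLeft (φ' i) b)
  right_perm : ∀ (a : M.Ob) {n : ℕ} {b : Fin n → N.Ob} {b' : N.Ob} (σ : Equiv.Perm (Fin n))
    (ψ : N.Hom b b'), mapRight a (N.perm σ ψ) = P.perm σ (mapRight a ψ)
  right_one : ∀ (a : M.Ob) (b : N.Ob), mapRight a (N.one b) = P.one (obj a b)
  right_comp : ∀ (a : M.Ob) {n : ℕ} {k : Fin n → ℕ} {b : ∀ i, Fin (k i) → N.Ob} {b' : Fin n → N.Ob}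
    {b'' : N.Ob} (ψ : N.Hom b' b'') (ψ' : ∀ i, N.Hom (b i) (b' i)),
    mapRight a (N.comp ψ ψ') = P.comp (mapRight a ψ) (fun i => mapRight a (ψ' i))
  interchange : ∀ {m n : ℕ} {a : Fin m → M.Ob} {a' : M.Ob} {b : Fin n → N.Ob} {b' : N.Ob}
    (φ : M.Hom a a') (ψ : N.Hom b b'),
    P.comp (mapRight a' ψ) (fun j => mapLeft φ (b j)) =
      P.relabel (shuffle n m) (concat_shuffle fun j i => obj (a i) (b j))
        (P.comp (mapLeft φ b') (fun i => mapRight (a i) ψ))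

/-- The composite of a bilinear map with a multifunctor. -/
def Bilin.postcomp {M N P Q : Multicategory.{u}} (f : Bilin M N P) (G : P ⟶ Q) : Bilin M N Q where
  obj a b := Multifunctor.obj G (f.obj a b)
  mapLeft φ b := Multifunctor.map G (f.mapLeft φ b)
  mapRight a _ _ _ ψ := Multifunctor.map G (f.mapRight a ψ)
  left_perm σ φ b := (congrArg _ (f.left_perm σ φ b)).trans (Multifunctor.map_perm G _ _)
  left_one a b := (congrArg _ (f.left_one a b)).trans (Multifunctor.map_one G _)
  left_comp φ φ' b := (congrArg _ (f.left_comp φ φ' b)).trans (Multifunctor.map_comp G _ _)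
  right_perm a _ _ _ σ ψ := (congrArg _ (f.right_perm a σ ψ)).trans (Multifunctor.map_perm G _ _)
  right_one a b := (congrArg _ (f.right_one a b)).trans (Multifunctor.map_one G _)
  right_comp a _ _ _ _ _ ψ ψ' :=
    (congrArg _ (f.right_comp a ψ ψ')).trans (Multifunctor.map_comp G _ _)
  interchange φ ψ := by
    refine (Multifunctor.map_comp G _ _).symm.trans
      ((congrArg (Multifunctor.map G) (f.interchange φ ψ)).trans ?_)
    exact (Multifunctor.map_relabel G _ _ _).trans (congrArg _ (Multifunctor.map_comp G _ _))

/-- The composite of a bilinear map with a multifunctor in each variable. -/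
def Bilin.precomp {M M' N N' P : Multicategory.{u}} (f : Bilin M' N' P) (F : M ⟶ M') (G : N ⟶ N') :
    Bilin M N P where
  obj a b := f.obj (Multifunctor.obj F a) (Multifunctor.obj G b)
  mapLeft φ b := f.mapLeft (Multifunctor.map F φ) (Multifunctor.obj G b)
  mapRight a _ _ _ ψ := f.mapRight (Multifunctor.obj F a) (Multifunctor.map G ψ)
  left_perm σ φ _ :=
    (congrArg (f.mapLeft · _) (Multifunctor.map_perm F σ φ)).trans (f.left_perm _ _ _)
  left_one a _ := (congrArg (f.mapLeft · _) (Multifunctor.map_one F a)).trans (f.left_one _ _)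
  left_comp φ φ' _ :=
    (congrArg (f.mapLeft · _) (Multifunctor.map_comp F φ φ')).trans (f.left_comp _ _ _)
  right_perm _ _ _ _ σ ψ :=
    (congrArg (f.mapRight _ ·) (Multifunctor.map_perm G σ ψ)).trans (f.right_perm _ _ _)
  right_one _ b := (congrArg (f.mapRight _ ·) (Multifunctor.map_one G b)).trans (f.right_one _ _)
  right_comp _ _ _ _ _ _ ψ ψ' :=
    (congrArg (f.mapRight _ ·) (Multifunctor.map_comp G ψ ψ')).trans (f.right_comp _ _ _)
  interchange φ ψ := f.interchange (Multifunctor.map F φ) (Multifunctor.map G ψ)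

/-- Formal expressions for the morphisms of `M ⊗ N`, generated by the symbols `φ ⊗ b` and `a ⊗ ψ`
under units, permutations and composition. -/
inductive TensorTerm (M N : Multicategory.{u}) :
    {k : ℕ} → (Fin k → M.Ob × N.Ob) → M.Ob × N.Ob → Type u
  | left {m : ℕ} {a : Fin m → M.Ob} {a' : M.Ob} (φ : M.Hom a a') (b : N.Ob) :
      TensorTerm M N (fun i => (a i, b)) (a', b)
  | right (a : M.Ob) {n : ℕ} {b : Fin n → N.Ob} {b' : N.Ob} (ψ : N.Hom b b') :
      TensorTerm M N (fun j => (a, b j)) (a, b')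
  | perm {k : ℕ} {x : Fin k → M.Ob × N.Ob} {y : M.Ob × N.Ob} (σ : Equiv.Perm (Fin k))
      (t : TensorTerm M N x y) : TensorTerm M N (fun i => x (σ i)) y
  | one (x : M.Ob × N.Ob) : TensorTerm M N (fun _ : Fin 1 => x) x
  | comp {n : ℕ} {k : Fin n → ℕ} {x : ∀ i, Fin (k i) → M.Ob × N.Ob} {y : Fin n → M.Ob × N.Ob}
      {z : M.Ob × N.Ob} (s : TensorTerm M N y z) (t : ∀ i, TensorTerm M N (x i) (y i)) :
      TensorTerm M N (concat x) z

abbrev termData (M N : Multicategory.{u}) : MultiData.{u} where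
  Ob := M.Ob × N.Ob
  Hom x y := TensorTerm M N x y
  perm σ t := .perm σ t
  one x := .one x
  comp s t := .comp s t

/-- The congruence on formal expressions generated by the identities of a multicategory, by
multifunctoriality of `φ ⊗ b` in `φ` and of `a ⊗ ψ` in `ψ`, and by the interchange relation between
the two. -/
inductive TensorRel (M N : Multicategory.{u}) :
    {k : ℕ} → {x : Fin k → M.Ob × N.Ob} → {y : M.Ob × N.Ob} →
      TensorTerm M N x y → TensorTerm M N x y → Prop
  | refl {k : ℕ} {x : Fin k → M.Ob × N.Ob} {y : M.Ob × N.Ob} (t : TensorTerm M N x y) :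
      TensorRel M N t t
  | symm {k : ℕ} {x : Fin k → M.Ob × N.Ob} {y : M.Ob × N.Ob} {s t : TensorTerm M N x y} :
      TensorRel M N s t → TensorRel M N t s
  | trans {k : ℕ} {x : Fin k → M.Ob × N.Ob} {y : M.Ob × N.Ob} {s t r : TensorTerm M N x y} :
      TensorRel M N s t → TensorRel M N t r → TensorRel M N s r
  | perm_congr {k : ℕ} {x : Fin k → M.Ob × N.Ob} {y : M.Ob × N.Ob} (σ : Equiv.Perm (Fin k))
      {s t : TensorTerm M N x y} : TensorRel M N s t → TensorRel M N (.perm σ s) (.perm σ t)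
  | comp_congr {n : ℕ} {k : Fin n → ℕ} {x : ∀ i, Fin (k i) → M.Ob × N.Ob}
      {y : Fin n → M.Ob × N.Ob} {z : M.Ob × N.Ob} {s s' : TensorTerm M N y z}
      {t t' : ∀ i, TensorTerm M N (x i) (y i)} : TensorRel M N s s' →
      (∀ i, TensorRel M N (t i) (t' i)) → TensorRel M N (.comp s t) (.comp s' t')
  | perm_one {k : ℕ} {x : Fin k → M.Ob × N.Ob} {y : M.Ob × N.Ob} (t : TensorTerm M N x y) :
      TensorRel M N (.perm (Equiv.refl (Fin k)) t) t
  | perm_perm {k : ℕ} {x : Fin k → M.Ob × N.Ob} {y : M.Ob × N.Ob} (σ τ : Equiv.Perm (Fin k))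
      (t : TensorTerm M N x y) : TensorRel M N (.perm σ (.perm τ t)) (.perm (σ.trans τ) t)
  | one_comp {k : ℕ} {x : Fin k → M.Ob × N.Ob} {y : M.Ob × N.Ob} (t : TensorTerm M N x y) :
      TensorRel M N (.comp (.one y) (fun _ : Fin 1 => t))
        ((termData M N).relabel (oneBlock k) (fun _ => rfl) t)
  | comp_one {n : ℕ} {x : Fin n → M.Ob × N.Ob} {y : M.Ob × N.Ob} (t : TensorTerm M N x y) :
      TensorRel M N (.comp t (fun i => .one (x i)))
        ((termData M N).relabel (blocksOfOne n) (fun _ => rfl) t)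
  | comp_comp {n : ℕ} {k : Fin n → ℕ} {l : ∀ i, Fin (k i) → ℕ}
      {x : ∀ i (j : Fin (k i)), Fin (l i j) → M.Ob × N.Ob} {y : ∀ i, Fin (k i) → M.Ob × N.Ob}
      {z : Fin n → M.Ob × N.Ob} {w : M.Ob × N.Ob} (t : TensorTerm M N z w)
      (s : ∀ i, TensorTerm M N (y i) (z i)) (r : ∀ i j, TensorTerm M N (x i j) (y i j)) :
      TensorRel M N
        (.comp (k := concat l) (.comp t s)
          (fun p => r (finSigmaFinEquiv.symm p).1 (finSigmaFinEquiv.symm p).2))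
        ((termData M N).relabel (assocEquiv l) (concat_assoc x)
          (TensorTerm.comp t (fun i => TensorTerm.comp (s i) (r i))))
  | perm_comp {n : ℕ} {k : Fin n → ℕ} {x : ∀ i, Fin (k i) → M.Ob × N.Ob}
      {y : Fin n → M.Ob × N.Ob} {z : M.Ob × N.Ob} (σ : Equiv.Perm (Fin n))
      (t : TensorTerm M N y z) (s : ∀ i, TensorTerm M N (x i) (y i)) :
      TensorRel M N (.comp (.perm σ t) (fun j => s (σ j)))
        ((termData M N).relabel (blockPerm σ k) (concat_reindex _ fun _ => rfl)
          (TensorTerm.comp t s))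
  | comp_perm {n : ℕ} {k : Fin n → ℕ} {x : ∀ i, Fin (k i) → M.Ob × N.Ob}
      {y : Fin n → M.Ob × N.Ob} {z : M.Ob × N.Ob} (t : TensorTerm M N y z)
      (τ : ∀ i, Equiv.Perm (Fin (k i))) (s : ∀ i, TensorTerm M N (x i) (y i)) :
      TensorRel M N (.comp t (fun i => .perm (τ i) (s i)))
        ((termData M N).relabel (blockSum τ) (concat_reindex _ fun _ => rfl)
          (TensorTerm.comp t s))
  | left_perm {m : ℕ} {a : Fin m → M.Ob} {a' : M.Ob} (σ : Equiv.Perm (Fin m)) (φ : M.Hom a a')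
      (b : N.Ob) : TensorRel M N (.left (M.perm σ φ) b) (.perm σ (.left φ b))
  | left_one (a : M.Ob) (b : N.Ob) : TensorRel M N (.left (M.one a) b) (.one (a, b))
  | left_comp {n : ℕ} {k : Fin n → ℕ} {a : ∀ i, Fin (k i) → M.Ob} {a' : Fin n → M.Ob} {a'' : M.Ob}
      (φ : M.Hom a' a'') (φ' : ∀ i, M.Hom (a i) (a' i)) (b : N.Ob) :
      TensorRel M N (.left (M.comp φ φ') b)
        (TensorTerm.comp (TensorTerm.left φ b) (fun i => TensorTerm.left (φ' i) b))
  | right_perm (a : M.Ob) {n : ℕ} {b : Fin n → N.Ob} {b' : N.Ob} (σ : Equiv.Perm (Fin n))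
      (ψ : N.Hom b b') : TensorRel M N (.right a (N.perm σ ψ)) (.perm σ (.right a ψ))
  | right_one (a : M.Ob) (b : N.Ob) : TensorRel M N (.right a (N.one b)) (.one (a, b))
  | right_comp (a : M.Ob) {n : ℕ} {k : Fin n → ℕ} {b : ∀ i, Fin (k i) → N.Ob} {b' : Fin n → N.Ob}
      {b'' : N.Ob} (ψ : N.Hom b' b'') (ψ' : ∀ i, N.Hom (b i) (b' i)) :
      TensorRel M N (.right a (N.comp ψ ψ'))
        (TensorTerm.comp (TensorTerm.right a ψ) (fun i => TensorTerm.right a (ψ' i)))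
  | interchange {m n : ℕ} {a : Fin m → M.Ob} {a' : M.Ob} {b : Fin n → N.Ob} {b' : N.Ob}
      (φ : M.Hom a a') (ψ : N.Hom b b') :
      TensorRel M N
        (TensorTerm.comp (TensorTerm.right a' ψ) (fun j => TensorTerm.left φ (b j)))
        ((termData M N).relabel (shuffle n m) (concat_shuffle fun j i => (a i, b j))
          (TensorTerm.comp (TensorTerm.left φ b') (fun i => TensorTerm.right (a i) ψ)))

section Tensor

variable (M N : Multicategory.{u})

def tensorSetoid {k : ℕ} (x : Fin k → M.Ob × N.Ob) (y : M.Ob × N.Ob) :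
    Setoid (TensorTerm M N x y) :=
  ⟨TensorRel M N, ⟨.refl, .symm, .trans⟩⟩

noncomputable abbrev tensorData : MultiData.{u} where
  Ob := M.Ob × N.Ob
  Hom x y := Quotient (tensorSetoid M N x y)
  perm {_ x y} σ := Quotient.map' (s₁ := tensorSetoid M N x y)
    (s₂ := tensorSetoid M N (fun i => x (σ i)) y) (TensorTerm.perm σ)
    (fun _ _ h => TensorRel.perm_congr σ h)
  one x := Quotient.mk _ (TensorTerm.one x)
  comp s t := Quotient.mk _ (TensorTerm.comp s.out (fun i => (t i).out))

variable {M N}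

abbrev tmk {k : ℕ} {x : Fin k → M.Ob × N.Ob} {y : M.Ob × N.Ob} (t : TensorTerm M N x y) :
    (tensorData M N).Hom x y := Quotient.mk (tensorSetoid M N x y) t

theorem tmk_sound {k : ℕ} {x : Fin k → M.Ob × N.Ob} {y : M.Ob × N.Ob} {s t : TensorTerm M N x y}
    (h : TensorRel M N s t) : tmk s = tmk t := Quotient.sound h

theorem tmk_perm {k : ℕ} {x : Fin k → M.Ob × N.Ob} {y : M.Ob × N.Ob} (σ : Equiv.Perm (Fin k))
    (t : TensorTerm M N x y) : (tensorData M N).perm σ (tmk t) = tmk (.perm σ t) := rfl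

theorem tmk_comp {n : ℕ} {k : Fin n → ℕ} {x : ∀ i, Fin (k i) → M.Ob × N.Ob}
    {y : Fin n → M.Ob × N.Ob} {z : M.Ob × N.Ob} (s : TensorTerm M N y z)
    (t : ∀ i, TensorTerm M N (x i) (y i)) :
    (tensorData M N).comp (tmk s) (fun i => tmk (t i)) = tmk (.comp s t) :=
  tmk_sound (.comp_congr (Quotient.mk_out (s := tensorSetoid M N _ _) s)
    (fun i => Quotient.mk_out (s := tensorSetoid M N _ _) (t i)))

theorem tmk_relabel {k l : ℕ} (e : Fin k ≃ Fin l) {x' : Fin k → M.Ob × N.Ob}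
    {x : Fin l → M.Ob × N.Ob} {y : M.Ob × N.Ob} (h : ∀ i, x' i = x (e i)) (t : TensorTerm M N x y) :
    (tensorData M N).relabel e h (tmk t) = tmk ((termData M N).relabel e h t) := by
  obtain rfl : k = l := Fin.equiv_iff_eq.mp ⟨e⟩
  obtain rfl : x' = fun i => x (e i) := funext h
  rfl

variable (M N)

/-- The tensor product `M ⊗ N`: the objects are the pairs `(a, b)`, the morphisms are generated by
the `φ ⊗ b` and `a ⊗ ψ`, and the only relations are those that make `(M, N) → M ⊗ N` bilinear. -/
noncomputable abbrev tensorObj : Multicategory.{u} where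
  toMultiData := tensorData M N
  perm_one f := by
    obtain ⟨t, rfl⟩ := Quotient.exists_rep f
    exact tmk_sound (.perm_one t)
  perm_perm σ τ f := by
    obtain ⟨t, rfl⟩ := Quotient.exists_rep f
    exact tmk_sound (.perm_perm σ τ t)
  one_comp f := by
    obtain ⟨t, rfl⟩ := Quotient.exists_rep f
    exact (tmk_comp _ _).trans ((tmk_sound (.one_comp t)).trans (tmk_relabel _ _ _).symm)
  comp_one f := by
    obtain ⟨t, rfl⟩ := Quotient.exists_rep f
    exact (tmk_comp _ _).trans ((tmk_sound (.comp_one t)).trans (tmk_relabel _ _ _).symm)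
  comp_comp f g h := by
    obtain ⟨t, rfl⟩ := Quotient.exists_rep f
    choose s hs using fun i => Quotient.exists_rep (g i)
    choose r hr using fun i j => Quotient.exists_rep (h i j)
    obtain rfl : (fun i => tmk (s i)) = g := funext hs
    obtain rfl : (fun i j => tmk (r i j)) = h := funext fun i => funext (hr i)
    refine (congrArg (fun z => (tensorData M N).comp z _) (tmk_comp t s)).trans ?_
    refine (tmk_comp _ _).trans ((tmk_sound (.comp_comp t s r)).trans ?_)
    refine (tmk_relabel _ _ _).symm.trans (congrArg _ ?_)
    exact (tmk_comp _ _).symm.trans (congrArg _ (funext fun i => (tmk_comp (s i) (r i)).symm))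
  perm_comp σ f g := by
    obtain ⟨t, rfl⟩ := Quotient.exists_rep f
    choose s hs using fun i => Quotient.exists_rep (g i)
    obtain rfl : (fun i => tmk (s i)) = g := funext hs
    refine (tmk_comp _ _).trans ((tmk_sound (.perm_comp σ t s)).trans ?_)
    exact (tmk_relabel _ _ _).symm.trans (congrArg _ (tmk_comp _ _).symm)
  comp_perm f τ g := by
    obtain ⟨t, rfl⟩ := Quotient.exists_rep f
    choose s hs using fun i => Quotient.exists_rep (g i)
    obtain rfl : (fun i => tmk (s i)) = g := funext hs
    refine (tmk_comp _ _).trans ((tmk_sound (.comp_perm t τ s)).trans ?_)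
    exact (tmk_relabel _ _ _).symm.trans (congrArg _ (tmk_comp _ _).symm)

end Tensor

section TensorUniversal

variable {M N P : Multicategory.{u}}

variable (M N) in
/-- The bilinear map `(M, N) → M ⊗ N`. -/
noncomputable def tensorBilin : Bilin M N (tensorObj M N) where
  obj a b := (a, b)
  mapLeft φ b := tmk (.left φ b)
  mapRight a _ _ _ ψ := tmk (.right a ψ)
  left_perm σ φ b := tmk_sound (.left_perm σ φ b)
  left_one a b := tmk_sound (.left_one a b)
  left_comp φ φ' b := (tmk_sound (.left_comp φ φ' b)).trans (tmk_comp _ _).symm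
  right_perm a _ _ _ σ ψ := tmk_sound (.right_perm a σ ψ)
  right_one a b := tmk_sound (.right_one a b)
  right_comp a _ _ _ _ _ ψ ψ' := (tmk_sound (.right_comp a ψ ψ')).trans (tmk_comp _ _).symm
  interchange φ ψ :=
    (tmk_comp _ _).trans ((tmk_sound (.interchange φ ψ)).trans
      ((tmk_relabel _ _ _).symm.trans (congrArg _ (tmk_comp _ _).symm)))

/-- Evaluation of formal expressions along a bilinear map. -/
def Bilin.eval (f : Bilin M N P) : ∀ {k : ℕ} {x : Fin k → M.Ob × N.Ob} {y : M.Ob × N.Ob},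
    TensorTerm M N x y → P.Hom (fun i => f.obj (x i).1 (x i).2) (f.obj y.1 y.2)
  | _, _, _, .left φ b => f.mapLeft φ b
  | _, _, _, .right a ψ => f.mapRight a ψ
  | _, _, _, .perm σ t => P.perm σ (f.eval t)
  | _, _, _, .one x => P.one (f.obj x.1 x.2)
  | _, _, _, .comp s t => P.comp (f.eval s) (fun i => f.eval (t i))

theorem Bilin.eval_relabel (f : Bilin M N P) {k l : ℕ} (e : Fin k ≃ Fin l)
    {x' : Fin k → M.Ob × N.Ob} {x : Fin l → M.Ob × N.Ob} {y : M.Ob × N.Ob}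
    (h : ∀ i, x' i = x (e i)) (t : TensorTerm M N x y) :
    f.eval ((termData M N).relabel e h t) =
      P.relabel e (fun i => congrArg (fun z => f.obj z.1 z.2) (h i)) (f.eval t) := by
  obtain rfl : k = l := Fin.equiv_iff_eq.mp ⟨e⟩
  obtain rfl : x' = fun i => x (e i) := funext h
  rfl

theorem Bilin.eval_rel (f : Bilin M N P) {k : ℕ} {x : Fin k → M.Ob × N.Ob} {y : M.Ob × N.Ob}
    {s t : TensorTerm M N x y} (h : TensorRel M N s t) : f.eval s = f.eval t := by
  induction h with
  | refl t => rfl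
  | symm _ ih => exact ih.symm
  | trans _ _ ih ih' => exact ih.trans ih'
  | perm_congr σ _ ih => exact congrArg (P.perm σ) ih
  | comp_congr _ _ ih ih' =>
    exact (congrArg (fun z => P.comp z _) ih).trans (congrArg (P.comp _) (funext ih'))
  | perm_one t => exact P.perm_one _
  | perm_perm σ τ t => exact P.perm_perm _ _ _
  | one_comp t =>
    refine (P.one_comp _).trans (Eq.symm ?_)
    exact f.eval_relabel _ _ _
  | comp_one t =>
    refine (P.comp_one _).trans (Eq.symm ?_)
    exact f.eval_relabel _ _ _
  | comp_comp t s r =>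
    refine (P.comp_comp (f.eval t) (fun i => f.eval (s i)) (fun i j => f.eval (r i j))).trans
      (Eq.symm ?_)
    exact f.eval_relabel _ _ _
  | perm_comp σ t s =>
    refine (P.perm_comp σ (f.eval t) (fun i => f.eval (s i))).trans (Eq.symm ?_)
    exact f.eval_relabel _ _ _
  | comp_perm t τ s =>
    refine (P.comp_perm (f.eval t) τ (fun i => f.eval (s i))).trans (Eq.symm ?_)
    exact f.eval_relabel _ _ _
  | left_perm σ φ b => exact f.left_perm σ φ b
  | left_one a b => exact f.left_one a b
  | left_comp φ φ' b => exact f.left_comp φ φ' b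
  | right_perm a σ ψ => exact f.right_perm a σ ψ
  | right_one a b => exact f.right_one a b
  | right_comp a ψ ψ' => exact f.right_comp a ψ ψ'
  | interchange φ ψ =>
    refine (f.interchange φ ψ).trans (Eq.symm ?_)
    exact f.eval_relabel _ _ _

/-- The multifunctor `M ⊗ N → P` induced by a bilinear map `(M, N) → P`. -/
noncomputable def Bilin.lift (f : Bilin M N P) : tensorObj M N ⟶ P :=
  ({ obj := fun x => f.obj x.1 x.2
     map := fun g => Quotient.lift f.eval (fun _ _ h => f.eval_rel h) g
     map_perm := fun σ g => by
      obtain ⟨t, rfl⟩ := Quotient.exists_rep g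
      rfl
     map_one := fun _ => rfl
     map_comp := fun g g' => by
      obtain ⟨t, rfl⟩ := Quotient.exists_rep g
      choose s hs using fun i => Quotient.exists_rep (g' i)
      obtain rfl : (fun i => tmk (s i)) = g' := funext hs
      exact congrArg (fun z => Quotient.lift f.eval (fun _ _ h => f.eval_rel h) z)
        (tmk_comp t s) } : Multifunctor (tensorObj M N) P)

end TensorUniversal

/-- The tensor product of multifunctors. -/
noncomputable def tensorMap {M M' N N' : Multicategory.{u}} (F : M ⟶ M') (G : N ⟶ N') :
    tensorObj M N ⟶ tensorObj M' N' :=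
  ((tensorBilin M' N').precomp F G).lift

/-- The multifunctor `- ⊗ b : M → M ⊗ N`. -/
noncomputable def tensorInl (M : Multicategory.{u}) {N : Multicategory.{u}} (b : N.Ob) :
    M ⟶ tensorObj M N :=
  ({ obj := fun a => (a, b)
     map := fun φ => (tensorBilin M N).mapLeft φ b
     map_perm := fun σ φ => (tensorBilin M N).left_perm σ φ b
     map_one := fun a => (tensorBilin M N).left_one a b
     map_comp := fun φ φ' => (tensorBilin M N).left_comp φ φ' b } : Multifunctor M (tensorObj M N))

/-- The multifunctor `a ⊗ - : N → M ⊗ N`. -/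
noncomputable def tensorInr {M : Multicategory.{u}} (N : Multicategory.{u}) (a : M.Ob) :
    N ⟶ tensorObj M N :=
  ({ obj := fun b => (a, b)
     map := fun ψ => (tensorBilin M N).mapRight a ψ
     map_perm := fun σ ψ => (tensorBilin M N).right_perm a σ ψ
     map_one := fun b => (tensorBilin M N).right_one a b
     map_comp := fun ψ ψ' => (tensorBilin M N).right_comp a ψ ψ' } : Multifunctor N (tensorObj M N))

/-- The multicategory with one object and only the identity morphism on that object. -/
def unitObj : Multicategory.{u} where
  Ob := PUnit
  Hom {k} _ _ := ULift (PLift (k = 1))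
  perm _ f := f
  one _ := ⟨⟨rfl⟩⟩
  comp f g := ⟨⟨by
    obtain ⟨⟨rfl⟩⟩ := f
    obtain ⟨⟨h⟩⟩ := g 0
    simp [h]⟩⟩
  perm_one _ := Subsingleton.elim _ _
  perm_perm _ _ _ := Subsingleton.elim _ _
  one_comp _ := Subsingleton.elim _ _
  comp_one _ := Subsingleton.elim _ _
  comp_comp _ _ _ := Subsingleton.elim _ _
  perm_comp _ _ _ := Subsingleton.elim _ _
  comp_perm _ _ _ := Subsingleton.elim _ _

/-- Functoriality of the internal Hom, by composition with multifunctors on both sides. -/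
def ihomMap {M M' N N' : Multicategory.{u}} (F : M' ⟶ M) (G : N ⟶ N') :
    ihomObj M N ⟶ ihomObj M' N' :=
  ({ obj := fun f => F ≫ Multifunctor.toHom f ≫ G
     map := fun ξ =>
      { app := fun a => Multifunctor.map G (KNatTrans.app ξ (Multifunctor.obj F a))
        naturality := fun φ => by
          refine (Multifunctor.map_comp G _ _).symm.trans
            ((congrArg (Multifunctor.map G) (KNatTrans.naturality ξ (Multifunctor.map F φ))).trans
              ?_)
          exact (Multifunctor.map_relabel G _ _ _).trans (congrArg _ (Multifunctor.map_comp G _ _)) }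
     map_perm := fun σ ξ => KNatTrans.ext (funext fun a => Multifunctor.map_perm G σ _)
     map_one := fun f => KNatTrans.ext (funext fun a => Multifunctor.map_one G _)
     map_comp := fun ξ ζ => KNatTrans.ext (funext fun a => Multifunctor.map_comp G _ _) } :
    Multifunctor (ihomObj M N) (ihomObj M' N'))

/-- The functor `Hom(N, -)`. -/
def ihomFunctor (N : Multicategory.{u}) : Multicategory.{u} ⥤ Multicategory.{u} where
  obj P := ihomObj N P
  map G := ihomMap (𝟙 N) G
  map_id _ := rfl
  map_comp _ _ := rfl

/-- The multifunctor `Hom(M ⊗ N, P) → Hom(M, Hom(N, P))` which sends a multifunctor `F` to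
`a ↦ F(a ⊗ -)`, and whose value on a `k`-natural transformation `ξ` has the components
`ξ_{(a, b)}`. -/
noncomputable def curryHom (M N P : Multicategory.{u}) :
    ihomObj (tensorObj M N) P ⟶ ihomObj M (ihomObj N P) :=
  ({ obj := fun F =>
      { obj := fun a => tensorInr N a ≫ Multifunctor.toHom F
        map := fun φ =>
          { app := fun b => Multifunctor.map F ((tensorBilin M N).mapLeft φ b)
            naturality := fun ψ => ((tensorBilin M N).postcomp F).interchange φ ψ }
        map_perm := fun σ φ => KNatTrans.ext (funext fun b =>
          ((tensorBilin M N).postcomp F).left_perm σ φ b)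
        map_one := fun a => KNatTrans.ext (funext fun b =>
          ((tensorBilin M N).postcomp F).left_one a b)
        map_comp := fun φ φ' => KNatTrans.ext (funext fun b =>
          ((tensorBilin M N).postcomp F).left_comp φ φ' b) }
     map := fun ξ =>
      { app := fun a =>
          { app := fun b => KNatTrans.app ξ (a, b)
            naturality := fun ψ => KNatTrans.naturality ξ ((tensorBilin M N).mapRight a ψ) }
        naturality := fun φ => KNatTrans.ext (funext fun b => by
          refine (KNatTrans.naturality ξ ((tensorBilin M N).mapLeft φ b)).trans (Eq.symm ?_)
          exact homData_relabel_app _ _ _ b) }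
     map_perm := fun _ _ => rfl
     map_one := fun _ => rfl
     map_comp := fun _ _ => rfl } :
    Multifunctor (ihomObj (tensorObj M N) P) (ihomObj M (ihomObj N P)))

/-- The multifunctor `M → Hom(N, P)` which corresponds to `F : M ⊗ N → P`. -/
noncomputable def curry {M N P : Multicategory.{u}} (F : tensorObj M N ⟶ P) : M ⟶ ihomObj N P :=
  Multifunctor.obj (curryHom M N P) F

open MonoidalCategory

/-- The data of a monoidal category on `Mult`, with the tensor product of multicategories and the
unit multicategory, for given associators and unitors. -/
noncomputable abbrev tensorStruct
    (α : ∀ M N P : Multicategory.{u},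
      tensorObj (tensorObj M N) P ≅ tensorObj M (tensorObj N P))
    (l : ∀ M : Multicategory.{u}, tensorObj unitObj M ≅ M)
    (r : ∀ M : Multicategory.{u}, tensorObj M unitObj ≅ M) :
    MonoidalCategoryStruct Multicategory.{u} where
  tensorObj := tensorObj
  whiskerLeft M _ _ G := tensorMap (𝟙 M) G
  whiskerRight F N := tensorMap F (𝟙 N)
  tensorHom := tensorMap
  tensorUnit := unitObj
  associator := α
  leftUnitor := l
  rightUnitor := r

/-- The data `S` satisfy the axioms of a monoidal category. -/
def IsMonoidal {C : Type*} [Category C] (S : MonoidalCategoryStruct C) : Prop :=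
  ∃ m : MonoidalCategory C, m.toMonoidalCategoryStruct = S

/-- The monoidal category whose underlying data are `S`. -/
abbrev IsMonoidal.monoidal {C : Type*} [Category C] {S : MonoidalCategoryStruct C}
    (h : IsMonoidal S) : MonoidalCategory C where
  toMonoidalCategoryStruct := S
  tensorHom_def := by obtain ⟨m, rfl⟩ := h; exact m.tensorHom_def
  id_tensorHom_id := by obtain ⟨m, rfl⟩ := h; exact m.id_tensorHom_id
  tensorHom_comp_tensorHom := by obtain ⟨m, rfl⟩ := h; exact m.tensorHom_comp_tensorHom
  whiskerLeft_id := by obtain ⟨m, rfl⟩ := h; exact m.whiskerLeft_id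
  id_whiskerRight := by obtain ⟨m, rfl⟩ := h; exact m.id_whiskerRight
  associator_naturality := by obtain ⟨m, rfl⟩ := h; exact m.associator_naturality
  leftUnitor_naturality := by obtain ⟨m, rfl⟩ := h; exact m.leftUnitor_naturality
  rightUnitor_naturality := by obtain ⟨m, rfl⟩ := h; exact m.rightUnitor_naturality
  pentagon := by obtain ⟨m, rfl⟩ := h; exact m.pentagon
  triangle := by obtain ⟨m, rfl⟩ := h; exact m.triangle

end EM

open EM

/-!
The plan is to construct everything on generators and to check every identity on generators.

A multifunctor `M ⊗ N → P` is determined by the bilinear map it restricts to (`lift_postcomp`, by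
induction on formal expressions). With `Bilin.lift` this is the universal property. A bilinear map
`(M, N) → P` is in turn the same thing as a multifunctor `M → Hom(N, P)`: the `m`-natural
transformation attached to `φ` has the components `f(φ, b)`, and its naturality is the interchange
relation. This gives the bijection `curry`, `uncurry`.

To extend it to an isomorphism `Hom(M ⊗ N, P) ≅ Hom(M, Hom(N, P))` of multicategories, a family
`ξ_{(a, b)}` that is natural with respect to the generators `φ ⊗ b` and `a ⊗ ψ` has to be natural
with respect to all morphisms of `M ⊗ N` (`uncurry_naturality`). The morphisms for which the
naturality square commutes must thus be closed under units, permutations and composition. The square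
says that two families of morphisms interchange up to a shuffle, a symmetric relation
(`Interchanges.symm`), and closure in one of the two arguments is proved in `Interchanges.one`,
`Interchanges.perm` and `Interchanges.comp`. Hence the multifunctor `uncurryHom` in the opposite
direction exists. It is a section of `curryHom` by definition, and `curryHom` is faithful and
injective on objects, hence a monomorphism, so it is an isomorphism.

The associator is the Yoneda image of
`Hom((M ⊗ N) ⊗ P, Q) ≅ Hom(M ⊗ N, Hom(P, Q)) ≅ Hom(M, Hom(N, Hom(P, Q))) ≅ Hom(M, Hom(N ⊗ P, Q))`
`≅ Hom(M ⊗ (N ⊗ P), Q)`; the symmetry comes from exchanging the two variables of a bilinear map, and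
the unitors from the fact that a multifunctor `I → M` is an object of `M` (`fromUnit`,
`eq_fromUnit`). By `tensor_hom_ext` two multifunctors on an iterated tensor product agree as soon as
they agree after restriction to each single variable, and there both sides of every coherence axiom
are the same by definition.
-/

namespace EM

/-! ### Multifunctors on a tensor product -/

section Ext

variable {M N P : Multicategory.{u}}

theorem lift_postcomp (F : tensorObj M N ⟶ P) : ((tensorBilin M N).postcomp F).lift = F := by
  refine Multifunctor.ext rfl (heq_of_eq ?_)
  funext k x y g
  obtain ⟨t, rfl⟩ := Quotient.exists_rep g
  change ((tensorBilin M N).postcomp F).eval t = Multifunctor.map F (tmk t)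
  induction t with
  | left φ b => rfl
  | right a ψ => rfl
  | perm σ t ih => exact (congrArg (P.perm σ) ih).trans (Multifunctor.map_perm F σ (tmk t)).symm
  | one x => exact (Multifunctor.map_one F x).symm
  | comp s t ih ih' =>
    refine ((congrArg (fun z => P.comp z _) ih).trans
      (congrArg (P.comp _) (funext ih'))).trans ?_
    exact (Multifunctor.map_comp F (tmk s) fun i => tmk (t i)).symm.trans
      (congrArg (Multifunctor.map F) (tmk_comp s t))

theorem postcomp_lift (f : Bilin M N P) : (tensorBilin M N).postcomp f.lift = f := rfl

/-- The two values have different types, since the objects of source and target depend on the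
multifunctor. -/
theorem Multifunctor.map_heq {F G : M ⟶ N} (h : F = G) {k : ℕ} {a : Fin k → M.Ob} {b : M.Ob}
    (φ : M.Hom a b) : HEq (Multifunctor.map F φ) (Multifunctor.map G φ) := by
  rw [h]

theorem mono_of_injective (F : M ⟶ N) (ho : Function.Injective (Multifunctor.obj F))
    (hm : ∀ {k : ℕ} {a : Fin k → M.Ob} {b : M.Ob},
      Function.Injective fun φ : M.Hom a b => Multifunctor.map F φ) : Mono F where
  right_cancellation G H h := by
    obtain ⟨g, _, _, _, _⟩ := G
    obtain ⟨g', _, _, _, _⟩ := H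
    obtain rfl : g = g' := funext fun q => ho (congrArg (fun K => Multifunctor.obj K q) h)
    congr 1
    funext k a b φ
    exact hm (eq_of_heq (Multifunctor.map_heq h φ))

/-- Evaluation `Hom(N, P) → P` at an object `b` of `N`. -/
def homEval (P : Multicategory.{u}) (b : N.Ob) : ihomObj N P ⟶ P :=
  ({ obj := fun F => Multifunctor.obj F b
     map := fun ξ => KNatTrans.app ξ b
     map_perm := fun _ _ => rfl
     map_one := fun _ => rfl
     map_comp := fun _ _ => rfl } : Multifunctor (ihomObj N P) P)

/-- The bilinear map `(M, N) → P` which corresponds to a multifunctor `M → Hom(N, P)`. -/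
def uncurryBilin (F : M ⟶ ihomObj N P) : Bilin M N P where
  obj a b := Multifunctor.obj (Multifunctor.obj F a) b
  mapLeft φ b := KNatTrans.app (Multifunctor.map F φ) b
  mapRight a _ _ _ ψ := Multifunctor.map (Multifunctor.obj F a) ψ
  left_perm σ φ b := Multifunctor.map_perm (F ≫ homEval P b) σ φ
  left_one a b := Multifunctor.map_one (F ≫ homEval P b) a
  left_comp φ φ' b := Multifunctor.map_comp (F ≫ homEval P b) φ φ'
  right_perm a _ _ _ σ ψ := Multifunctor.map_perm (Multifunctor.obj F a) σ ψ
  right_one a b := Multifunctor.map_one (Multifunctor.obj F a) b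
  right_comp a _ _ _ _ _ ψ ψ' := Multifunctor.map_comp (Multifunctor.obj F a) ψ ψ'
  interchange φ ψ := KNatTrans.naturality (Multifunctor.map F φ) ψ

/-- The multifunctor `M ⊗ N → P` which corresponds to `F : M → Hom(N, P)`. -/
noncomputable def uncurry (F : M ⟶ ihomObj N P) : tensorObj M N ⟶ P := (uncurryBilin F).lift

theorem curry_uncurry (F : M ⟶ ihomObj N P) : curry (uncurry F) = F := rfl

theorem uncurry_curry (F : tensorObj M N ⟶ P) : uncurry (curry F) = F := lift_postcomp F

theorem ihom_hom_ext {F G : M ⟶ ihomObj N P}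
    (hl : ∀ b, F ≫ homEval P b = G ≫ homEval P b)
    (hr : ∀ a, Multifunctor.obj F a = Multifunctor.obj G a) : F = G := by
  obtain ⟨f, _, _, _, _⟩ := F
  obtain ⟨g, _, _, _, _⟩ := G
  obtain rfl : f = g := funext hr
  congr 1
  funext k a b φ
  exact KNatTrans.ext (funext fun b => eq_of_heq (Multifunctor.map_heq (hl b) φ))

/-- Multifunctors on `M ⊗ N` agree if they agree on the generators. The statement avoids
heterogeneous equalities between values at generators by comparing restrictions to one variable. -/
theorem tensor_hom_ext {F G : tensorObj M N ⟶ P}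
    (hl : ∀ b, tensorInl M b ≫ F = tensorInl M b ≫ G)
    (hr : ∀ a, tensorInr N a ≫ F = tensorInr N a ≫ G) : F = G := by
  -- `tensorInl M b ≫ F` is `curry F ≫ homEval P b`, and `tensorInr N a ≫ F` is `(curry F).obj a`.
  rw [← uncurry_curry F, ihom_hom_ext (F := curry F) (G := curry G) hl hr, uncurry_curry]

end Ext

/-! ### Interchange of families of morphisms -/

section Interchange

variable {N : Multicategory.{u}}

/-- The `m`-morphisms `φ`, `φ'` and the `k`-morphisms `ξ`, `ξ'`, arranged around an `m × k` matrix
`x` of objects, interchange: the two composites from the entries of `x` to `w` agree up to the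
shuffle. -/
def Interchanges {m k : ℕ} {x : Fin m → Fin k → N.Ob} {y : Fin m → N.Ob} {z : Fin k → N.Ob}
    {w : N.Ob} (φ : N.Hom y w) (φ' : ∀ j, N.Hom (fun i => x i j) (z j)) (ξ : N.Hom z w)
    (ξ' : ∀ i, N.Hom (x i) (y i)) : Prop :=
  N.comp φ ξ' = N.relabel (shuffle m k) (concat_shuffle x) (N.comp ξ φ')

theorem shuffle_trans_shuffle (m k : ℕ) :
    (shuffle m k).trans (shuffle k m) = Equiv.refl _ := by
  refine Equiv.ext fun p => ?_
  obtain ⟨x, rfl⟩ := (finSigmaFinEquiv (n := fun _ : Fin m => k)).surjective p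
  simp [shuffle, reindex]

theorem Interchanges.symm {m k : ℕ} {x : Fin m → Fin k → N.Ob} {y : Fin m → N.Ob}
    {z : Fin k → N.Ob} {w : N.Ob} {φ : N.Hom y w} {φ' : ∀ j, N.Hom (fun i => x i j) (z j)}
    {ξ : N.Hom z w} {ξ' : ∀ i, N.Hom (x i) (y i)} (h : Interchanges φ φ' ξ ξ') :
    Interchanges (x := fun j i => x i j) ξ ξ' φ φ' := by
  refine Eq.symm ((congrArg (N.relabel _ _) h).trans ?_)
  exact (N.relabel_relabel _ _ _ _ _).trans
    ((N.relabel_congr (shuffle_trans_shuffle k m) _ _ _).trans (N.relabel_refl _))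

theorem Interchanges.one {m : ℕ} {y : Fin m → N.Ob} {w : N.Ob} (φ : N.Hom y w) :
    Interchanges (x := fun i (_ : Fin 1) => y i) φ (fun _ => φ) (N.one w)
      (fun i => N.one (y i)) := by
  refine (N.comp_one φ).trans (Eq.symm ?_)
  refine (congrArg (N.relabel _ _) (N.one_comp φ)).trans ?_
  refine (N.relabel_relabel _ _ _ _ _).trans (N.relabel_congr (Equiv.ext fun p => ?_) _ _ _)
  obtain ⟨x, rfl⟩ := (finSigmaFinEquiv (n := fun _ : Fin m => 1)).surjective p
  simp [blocksOfOne, oneBlock, shuffle, reindex]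

theorem Interchanges.perm {m k : ℕ} {x : Fin m → Fin k → N.Ob} {y : Fin m → N.Ob}
    {z : Fin k → N.Ob} {w : N.Ob} {φ : N.Hom y w} {φ' : ∀ j, N.Hom (fun i => x i j) (z j)}
    {ξ : N.Hom z w} {ξ' : ∀ i, N.Hom (x i) (y i)} (σ : Equiv.Perm (Fin k))
    (h : Interchanges φ φ' ξ ξ') :
    Interchanges (x := fun i j => x i (σ j)) φ (fun j => φ' (σ j)) (N.perm σ ξ)
      (fun i => N.perm σ (ξ' i)) := by
  refine (N.comp_perm φ (fun _ => σ) ξ').trans ?_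
  refine (congrArg (N.relabel _ _) h).trans ?_
  refine (N.relabel_relabel _ _ _ _ _).trans (Eq.symm ?_)
  refine (congrArg (N.relabel _ _) (N.perm_comp σ ξ φ')).trans ?_
  refine (N.relabel_relabel _ _ _ _ _).trans (N.relabel_congr (Equiv.ext fun p => ?_) _ _ _)
  obtain ⟨x, rfl⟩ := (finSigmaFinEquiv (n := fun _ : Fin m => k)).surjective p
  simp [blockSum, blockPerm, shuffle, reindex, Equiv.sigmaCongrLeft]

/-- Interchange is closed under composition in the second family: a morphism that interchanges with
`ξ` and then with each `ζ i` interchanges with their composite. -/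
theorem Interchanges.comp {m n : ℕ} {k : Fin n → ℕ} {x : Fin m → ∀ i, Fin (k i) → N.Ob}
    {v : Fin m → Fin n → N.Ob} {u : ∀ i, Fin (k i) → N.Ob} {y : Fin m → N.Ob} {z : Fin n → N.Ob}
    {w : N.Ob} {φ : N.Hom y w} {φ' : ∀ i, N.Hom (fun s => v s i) (z i)}
    {φ'' : ∀ i j, N.Hom (fun s => x s i j) (u i j)} {ξ : N.Hom z w} {ξ' : ∀ s, N.Hom (v s) (y s)}
    {ζ : ∀ i, N.Hom (u i) (z i)} {ζ' : ∀ s i, N.Hom (x s i) (v s i)}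
    (h : Interchanges φ φ' ξ ξ')
    (h' : ∀ i, Interchanges (x := fun s => x s i) (φ' i) (φ'' i) (ζ i) (fun s => ζ' s i)) :
    Interchanges (x := fun s => concat (x s)) φ
      (fun p => φ'' (finSigmaFinEquiv.symm p).1 (finSigmaFinEquiv.symm p).2)
      (N.comp ξ ζ) (fun s => N.comp (ξ' s) (ζ' s)) := by
  -- Reassociate, interchange `φ` with `ξ`, reassociate, interchange each `φ' i` with `ζ i`, and
  -- reassociate; the permutations collected on the way are compared at the end.
  have h1 := N.comp_comp φ ξ' ζ'
  have h2 := congrArg (fun F => N.comp (k := concat fun _ i => k i) F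
    (fun p => ζ' (finSigmaFinEquiv.symm p).1 (finSigmaFinEquiv.symm p).2)) h
  have h3 := N.relabel_comp (J := Fin m × Fin n) (κ := fun q => k q.2)
    (α' := fun q => x q.1 q.2) (β := fun q => v q.1 q.2)
    (fun q => ζ' q.1 q.2)
    (v := fun p : Fin (∑ _i : Fin m, n) =>
      ((finSigmaFinEquiv.symm p).1, (finSigmaFinEquiv.symm p).2))
    (w := fun p : Fin (∑ _i : Fin n, m) =>
      ((finSigmaFinEquiv.symm p).2, (finSigmaFinEquiv.symm p).1))
    (shuffle m n) (by
      intro p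
      obtain ⟨x, rfl⟩ := (finSigmaFinEquiv (n := fun _ : Fin m => n)).surjective p
      simp [shuffle, reindex]) (N.comp ξ φ')
  have h4 := N.comp_comp ξ φ' (fun i s => ζ' s i)
  have h5 := congrArg (N.comp ξ) (funext h')
  have h6 := N.comp_relabel ξ (fun i => shuffle m (k i))
    (fun i => concat_shuffle fun s => x s i) (fun i => N.comp (ζ i) (φ'' i))
  have h7 := N.comp_comp ξ ζ φ''
  refine N.relabel_injective _ _ (h1.symm.trans (h2.trans (h3.trans ?_)))
  refine (congrArg (N.relabel _ _) (h4.trans (congrArg (N.relabel _ _)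
    (h5.trans h6)))).trans (Eq.symm ?_)
  refine (congrArg (N.relabel _ _) (congrArg (N.relabel _ _) h7)).trans ?_
  refine (congrArg (N.relabel _ _) (N.relabel_relabel _ _ _ _ _)).trans
    ((N.relabel_relabel _ _ _ _ _).trans (Eq.symm ?_))
  refine (congrArg (N.relabel _ _) (N.relabel_relabel _ _ _ _ _)).trans
    ((N.relabel_relabel _ _ _ _ _).trans (N.relabel_congr (Equiv.ext fun p => ?_) _ _ _))
  -- Both permutations take the entry `(s, i, t)`, in lexicographic order, to `(i, t, s)`.
  obtain ⟨⟨q, t⟩, rfl⟩ := finSigmaFinEquiv.surjective p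
  obtain ⟨⟨s, i⟩, rfl⟩ := (finSigmaFinEquiv (n := fun _ : Fin m => n)).surjective q
  have hk : concat (fun (_ : Fin m) i => k i) (finSigmaFinEquiv ⟨s, i⟩) = k i := concat_apply _ _
  have hsh : shuffle m n (finSigmaFinEquiv ⟨s, i⟩) = finSigmaFinEquiv ⟨i, s⟩ := reindex_apply _ _
  have hq : (finSigmaFinEquiv (n := fun _ : Fin m => n)).symm (finSigmaFinEquiv ⟨s, i⟩) =
      ⟨s, i⟩ := Equiv.symm_apply_apply _ _
  simp only [Equiv.trans_apply]
  refine Eq.trans (b := finSigmaFinEquiv (n := fun i => ∑ _j : Fin (k i), m)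
    ⟨i, finSigmaFinEquiv (n := fun _ : Fin (k i) => m) ⟨Fin.cast hk t, s⟩⟩) ?_ (Eq.symm ?_)
  · refine (congrArg _ (congrArg _ (reindex_apply _ _))).trans ?_
    refine (congrArg _ (assocEquiv_eq _ _ _ ⟨i, s⟩ (by rw [Equiv.symm_apply_eq]; exact hsh)
      (Fin.cast hk t) rfl)).trans ?_
    refine (reindex_apply _ _).trans (congrArg finSigmaFinEquiv (Sigma.ext rfl (heq_of_eq ?_)))
    exact reindex_apply _ _
  · have e1 : assocEquiv (fun (_ : Fin m) i => k i)
        (finSigmaFinEquiv ⟨finSigmaFinEquiv ⟨s, i⟩, t⟩) =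
        finSigmaFinEquiv ⟨s, finSigmaFinEquiv ⟨i, Fin.cast hk t⟩⟩ :=
      assocEquiv_eq (k := fun _ : Fin m => n) (fun (_ : Fin m) i => k i)
        (finSigmaFinEquiv (n := fun _ : Fin m => n) ⟨s, i⟩) t ⟨s, i⟩ hq (Fin.cast hk t) rfl
    have e2 : shuffle m (∑ i, k i)
        (finSigmaFinEquiv ⟨s, finSigmaFinEquiv ⟨i, Fin.cast hk t⟩⟩) =
        finSigmaFinEquiv ⟨finSigmaFinEquiv ⟨i, Fin.cast hk t⟩, s⟩ := reindex_apply _ _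
    have e3 : assocEquiv (fun i (_ : Fin (k i)) => m)
        (finSigmaFinEquiv (n := concat fun i (_ : Fin (k i)) => m)
          ⟨finSigmaFinEquiv ⟨i, Fin.cast hk t⟩, s⟩) =
        finSigmaFinEquiv ⟨i, finSigmaFinEquiv ⟨Fin.cast hk t, s⟩⟩ :=
      assocEquiv_const m ⟨i, Fin.cast hk t⟩ s
    exact (congrArg (fun z => assocEquiv (fun i (_ : Fin (k i)) => m)
      (shuffle m (∑ i, k i) z)) e1).trans
        ((congrArg (assocEquiv fun i (_ : Fin (k i)) => m) e2).trans e3)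

end Interchange

/-! ### The internal Hom out of a tensor product -/

section CurryHom

variable {M N P : Multicategory.{u}}

/-- A `k`-natural transformation between the curried multifunctors is natural with respect to every
morphism of `M ⊗ N`. -/
theorem uncurry_naturality {k : ℕ} {F : Fin k → Multifunctor M (ihomObj N P)}
    {G : Multifunctor M (ihomObj N P)} (ξ : KNatTrans F G) {m : ℕ} {x : Fin m → M.Ob × N.Ob}
    {y : M.Ob × N.Ob} (t : TensorTerm M N x y) :
    Interchanges ((uncurryBilin G).eval t) (fun j => (uncurryBilin (F j)).eval t)
      (KNatTrans.app (ξ.app y.1) y.2) (fun i => KNatTrans.app (ξ.app (x i).1) (x i).2) := by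
  induction t with
  | left φ b =>
    refine (congrArg (fun ζ => KNatTrans.app ζ b) (ξ.naturality φ)).trans ?_
    exact homData_relabel_app _ _ _ b
  | right a ψ => exact (ξ.app a).naturality ψ
  | perm σ t ih => exact (ih.symm.perm σ).symm
  | one x => exact (Interchanges.one (KNatTrans.app (ξ.app x.1) x.2)).symm
  | comp s t ih ih' => exact (Interchanges.comp ih.symm fun i => (ih' i).symm).symm

/-- The multifunctor `Hom(M, Hom(N, P)) → Hom(M ⊗ N, P)` inverse to `curryHom`. -/
noncomputable def uncurryHom (M N P : Multicategory.{u}) :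
    ihomObj M (ihomObj N P) ⟶ ihomObj (tensorObj M N) P :=
  ({ obj := fun F => uncurry F
     map := fun ξ =>
      { app := fun x => KNatTrans.app (KNatTrans.app ξ x.1) x.2
        naturality := fun φ => by
          obtain ⟨t, rfl⟩ := Quotient.exists_rep φ
          exact uncurry_naturality ξ t }
     map_perm := fun _ _ => rfl
     map_one := fun _ => rfl
     map_comp := fun _ _ => rfl } :
    Multifunctor (ihomObj M (ihomObj N P)) (ihomObj (tensorObj M N) P))

theorem uncurryHom_curryHom : uncurryHom M N P ≫ curryHom M N P = 𝟙 _ := rfl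

instance : Mono (curryHom M N P) :=
  mono_of_injective _ (Function.LeftInverse.injective uncurry_curry)
    fun h => KNatTrans.ext (funext fun x : M.Ob × N.Ob =>
      congrArg (fun θ => KNatTrans.app (KNatTrans.app θ x.1) x.2) h)

instance : IsIso (curryHom M N P) :=
  have : IsSplitEpi (curryHom M N P) := ⟨⟨⟨uncurryHom M N P, uncurryHom_curryHom⟩⟩⟩
  isIso_of_mono_of_isSplitEpi _

end CurryHom

/-! ### Associativity -/

section Assoc

variable (M N P : Multicategory.{u})

/-- The multifunctor `(x ⊗ y) ⊗ z ↦ x ⊗ (y ⊗ z)`, obtained by Yoneda from the identity of its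
target. -/
noncomputable def assocHom : tensorObj (tensorObj M N) P ⟶ tensorObj M (tensorObj N P) :=
  uncurry (uncurry (curry (𝟙 _) ≫ curryHom N P _))

/-- The multifunctor `x ⊗ (y ⊗ z) ↦ (x ⊗ y) ⊗ z`, obtained by Yoneda from the identity of its
target. -/
noncomputable def assocInv : tensorObj M (tensorObj N P) ⟶ tensorObj (tensorObj M N) P :=
  uncurry (curry (curry (𝟙 _)) ≫ uncurryHom N P _)

/-- The associator. -/
noncomputable def assocIso : tensorObj (tensorObj M N) P ≅ tensorObj M (tensorObj N P) where
  hom := assocHom M N P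
  inv := assocInv M N P
  hom_inv_id :=
    tensor_hom_ext (fun _ => tensor_hom_ext (fun _ => rfl) fun _ => rfl) fun _ => rfl
  inv_hom_id :=
    tensor_hom_ext (fun _ => rfl) fun _ => tensor_hom_ext (fun _ => rfl) fun _ => rfl

end Assoc

/-! ### Symmetry -/

section Flip

variable {M N P : Multicategory.{u}}

/-- The bilinear map `(N, M) → P` obtained by exchanging the two variables. -/
def Bilin.flip (f : Bilin M N P) : Bilin N M P where
  obj b a := f.obj a b
  mapLeft ψ a := f.mapRight a ψ
  mapRight b _ _ _ φ := f.mapLeft φ b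
  left_perm σ ψ a := f.right_perm a σ ψ
  left_one b a := f.right_one a b
  left_comp ψ ψ' a := f.right_comp a ψ ψ'
  right_perm b _ _ _ σ φ := f.left_perm σ φ b
  right_one b a := f.left_one a b
  right_comp b _ _ _ _ _ φ φ' := f.left_comp φ φ' b
  interchange ψ φ := Interchanges.symm (f.interchange φ ψ)

variable (M N)

/-- The multifunctor `x ⊗ y ↦ y ⊗ x`. -/
noncomputable def braidHom : tensorObj M N ⟶ tensorObj N M := (tensorBilin N M).flip.lift

theorem braidHom_braidHom : braidHom M N ≫ braidHom N M = 𝟙 _ :=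
  tensor_hom_ext (fun _ => rfl) fun _ => rfl

/-- The symmetry isomorphism. -/
noncomputable def braidIso : tensorObj M N ≅ tensorObj N M where
  hom := braidHom M N
  inv := braidHom N M
  hom_inv_id := braidHom_braidHom M N
  inv_hom_id := braidHom_braidHom N M

end Flip

/-! ### The unit -/

section Unit

variable (M : Multicategory.{u})

/-- Composites of identities are identities. The arities are only provably equal to `1`, so the
identities appear transported along bijections. -/
theorem relabel_one_comp_relabel_one (q : M.Ob) {n : ℕ} {k : Fin n → ℕ} (e : Fin n ≃ Fin 1)
    (e' : ∀ i, Fin (k i) ≃ Fin 1) (e'' : Fin (∑ i, k i) ≃ Fin 1) :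
    M.relabel e'' (a' := concat fun _ _ => q) (fun _ => rfl) (M.one q) =
      M.comp (M.relabel e (a' := fun _ => q) (fun _ => rfl) (M.one q))
        (fun i => M.relabel (e' i) (a' := fun _ => q) (fun _ => rfl) (M.one q)) := by
  obtain rfl : n = 1 := Fin.equiv_iff_eq.mp ⟨e⟩
  obtain rfl : k = fun _ => 1 := funext fun i => Fin.equiv_iff_eq.mp ⟨e' i⟩
  obtain rfl : e = Equiv.refl _ := Subsingleton.elim _ _
  obtain rfl : e' = fun _ => Equiv.refl _ := Subsingleton.elim _ _
  rw [M.relabel_refl]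
  refine Eq.trans ?_ (congrArg (M.comp _) (funext fun i => (M.relabel_refl _).symm))
  refine Eq.trans ?_ (M.comp_one (M.one q)).symm
  exact M.relabel_congr (Subsingleton.elim _ _) _ _ _

/-- The multifunctor from the unit multicategory that picks out an object. A morphism of the unit
multicategory of arity `k` is a proof of `k = 1`, along which the identity is transported. -/
def fromUnit (q : M.Ob) : unitObj ⟶ M :=
  ({ obj := fun _ => q
     map := fun f => M.relabel (finCongr f.down.down) (fun _ => rfl) (M.one q)
     map_perm := fun {k a b} σ f => by
      refine Eq.trans ?_ (M.relabel_relabel σ (finCongr f.down.down) (fun _ => rfl)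
        (fun _ => rfl) (M.one q)).symm
      exact M.relabel_congr (Subsingleton.elim _ _) _ _ _
     map_one := fun _ => M.relabel_refl _
     map_comp := fun f g => relabel_one_comp_relabel_one M q _ _ _ } :
    Multifunctor unitObj M)

variable {M}

theorem eq_fromUnit (F : unitObj ⟶ M) : F = fromUnit M (Multifunctor.obj F PUnit.unit) := by
  refine Multifunctor.ext rfl (heq_of_eq ?_)
  funext k a b f
  have h : f = unitObj.relabel (finCongr f.down.down) (fun _ => rfl) (unitObj.one PUnit.unit) :=
    Subsingleton.elim (α := ULift (PLift (k = 1))) _ _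
  refine (congrArg (Multifunctor.map F) h).trans ((Multifunctor.map_relabel F _ _ _).trans ?_)
  exact congrArg (M.relabel _ _) (Multifunctor.map_one F _)

theorem unit_hom_ext {F G : unitObj ⟶ M}
    (h : Multifunctor.obj F PUnit.unit = Multifunctor.obj G PUnit.unit) : F = G := by
  rw [eq_fromUnit F, h, ← eq_fromUnit]

variable (M)

/-- The left unitor `* ⊗ x ↦ x`. It corresponds to the multifunctor `I → Hom(M, M)` that picks out
the identity. -/
noncomputable def leftUnit : tensorObj unitObj M ≅ M where
  hom := uncurry (fromUnit (ihomObj M M) (𝟙 M))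
  inv := tensorInr M PUnit.unit
  hom_inv_id := tensor_hom_ext (fun _ => unit_hom_ext rfl) fun _ => rfl
  inv_hom_id := rfl

/-- The right unitor `x ⊗ * ↦ x`. -/
noncomputable def rightUnit : tensorObj M unitObj ≅ M := braidIso M unitObj ≪≫ leftUnit M

end Unit

/-! ### The symmetric monoidal closed structure -/

section Monoidal

variable {A B C D : Multicategory.{u}}

theorem tensor_tensor_hom_ext {F G : tensorObj (tensorObj A B) C ⟶ D}
    (h1 : ∀ b c, tensorInl A b ≫ tensorInl (tensorObj A B) c ≫ F =
      tensorInl A b ≫ tensorInl (tensorObj A B) c ≫ G)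
    (h2 : ∀ a c, tensorInr B a ≫ tensorInl (tensorObj A B) c ≫ F =
      tensorInr B a ≫ tensorInl (tensorObj A B) c ≫ G)
    (h3 : ∀ a b, tensorInr (M := tensorObj A B) C (a, b) ≫ F =
      tensorInr (M := tensorObj A B) C (a, b) ≫ G) : F = G :=
  tensor_hom_ext (fun c => tensor_hom_ext (h1 · c) (h2 · c)) fun x => h3 x.1 x.2

/-- The data of the monoidal category of multicategories. -/
noncomputable abbrev multStruct : MonoidalCategoryStruct Multicategory.{u} :=
  tensorStruct assocIso leftUnit rightUnit

/-- After restriction to one variable, the two sides of each axiom are equal by definition, or are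
multifunctors on the unit multicategory with the same value on its object. -/
theorem isMonoidal_multStruct : IsMonoidal multStruct.{u} :=
  ⟨{ toMonoidalCategoryStruct := multStruct
     tensorHom_def := fun _ _ => tensor_hom_ext (fun _ => rfl) fun _ => rfl
     id_tensorHom_id := fun _ _ => tensor_hom_ext (fun _ => rfl) fun _ => rfl
     tensorHom_comp_tensorHom := fun _ _ _ _ => tensor_hom_ext (fun _ => rfl) fun _ => rfl
     whiskerLeft_id := fun _ _ => tensor_hom_ext (fun _ => rfl) fun _ => rfl
     id_whiskerRight := fun _ _ => tensor_hom_ext (fun _ => rfl) fun _ => rfl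
     associator_naturality := fun _ _ _ =>
      tensor_tensor_hom_ext (fun _ _ => rfl) (fun _ _ => rfl) fun _ _ => rfl
     leftUnitor_naturality := fun _ => tensor_hom_ext (fun _ => unit_hom_ext rfl) fun _ => rfl
     rightUnitor_naturality := fun _ => tensor_hom_ext (fun _ => rfl) fun _ => unit_hom_ext rfl
     pentagon := fun _ _ _ _ =>
      tensor_hom_ext (fun _ =>
        tensor_tensor_hom_ext (fun _ _ => rfl) (fun _ _ => rfl) fun _ _ => rfl) fun _ => rfl
     triangle := fun _ _ =>
      tensor_tensor_hom_ext (fun _ _ => rfl) (fun _ _ => unit_hom_ext rfl) fun _ _ => rfl }, rfl⟩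

noncomputable instance : MonoidalCategory Multicategory.{u} := isMonoidal_multStruct.monoidal

noncomputable instance : SymmetricCategory Multicategory.{u} where
  braiding := braidIso
  braiding_naturality_right := fun _ _ _ _ => tensor_hom_ext (fun _ => rfl) fun _ => rfl
  braiding_naturality_left := fun _ _ => tensor_hom_ext (fun _ => rfl) fun _ => rfl
  hexagon_forward := fun _ _ _ =>
    tensor_tensor_hom_ext (fun _ _ => rfl) (fun _ _ => rfl) fun _ _ => rfl
  hexagon_reverse := fun _ _ _ =>
    tensor_hom_ext (fun _ => rfl) fun _ => tensor_hom_ext (fun _ => rfl) fun _ => rfl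
  symmetry := braidHom_braidHom

/-- The adjunction between `- ⊗ N` and `Hom(N, -)`, by currying. -/
noncomputable def tensorHomAdj (N : Multicategory.{u}) :
    MonoidalCategory.tensorRight N ⊣ ihomFunctor N :=
  Adjunction.mkOfHomEquiv
    { homEquiv := fun _ _ =>
        { toFun := curry
          invFun := uncurry
          left_inv := uncurry_curry
          right_inv := curry_uncurry }
      homEquiv_naturality_left_symm := fun _ _ => tensor_hom_ext (fun _ => rfl) fun _ => rfl
      homEquiv_naturality_right := fun _ _ => rfl }

end Monoidal

end EM

theorem mainTheorem4 :
    -- `(M, N) → M ⊗ N` is a universal bilinear map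
    (∀ (M N P : Multicategory.{u}) (f : Bilin M N P),
      ∃! F : tensorObj M N ⟶ P, (tensorBilin M N).postcomp F = f) ∧
    -- the Hom-tensor adjunction is an isomorphism of multicategories, natural in all variables
    (∀ M N P : Multicategory.{u}, IsIso (curryHom M N P)) ∧
    (∀ (M M' N N' P P' : Multicategory.{u}) (F : M' ⟶ M) (G : N' ⟶ N) (H : P ⟶ P'),
      ihomMap (tensorMap F G) H ≫ curryHom M' N' P' =
        curryHom M N P ≫ ihomMap F (ihomMap G H)) ∧
    -- `⊗` is part of a symmetric monoidal structure, with the expected structure isomorphisms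
    ∃ (α : ∀ M N P : Multicategory.{u},
        tensorObj (tensorObj M N) P ≅ tensorObj M (tensorObj N P))
      (l : ∀ M : Multicategory.{u}, tensorObj unitObj M ≅ M)
      (r : ∀ M : Multicategory.{u}, tensorObj M unitObj ≅ M)
      (h : IsMonoidal (tensorStruct α l r)),
      letI := h.monoidal
      (∀ (M N P : Multicategory.{u}) (b : N.Ob) (c : P.Ob),
        tensorInl M b ≫ tensorInl (tensorObj M N) c ≫ (α M N P).hom =
          tensorInl M (N := tensorObj N P) (b, c)) ∧
      (∀ (M N P : Multicategory.{u}) (a : M.Ob) (c : P.Ob),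
        tensorInr N a ≫ tensorInl (tensorObj M N) c ≫ (α M N P).hom =
          tensorInl N c ≫ tensorInr (tensorObj N P) a) ∧
      (∀ (M N P : Multicategory.{u}) (a : M.Ob) (b : N.Ob),
        tensorInr (M := tensorObj M N) P (a, b) ≫ (α M N P).hom =
          tensorInr P b ≫ tensorInr (tensorObj N P) a) ∧
      (∀ M : Multicategory.{u}, tensorInr (M := unitObj) M PUnit.unit ≫ (l M).hom = 𝟙 M) ∧
      (∀ M : Multicategory.{u}, tensorInl M (N := unitObj) PUnit.unit ≫ (r M).hom = 𝟙 M) ∧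
      ∃ _ : SymmetricCategory Multicategory.{u},
        (∀ (M N : Multicategory.{u}) (b : N.Ob),
          tensorInl M b ≫ (BraidedCategory.braiding M N).hom = tensorInr M b) ∧
        (∀ (M N : Multicategory.{u}) (a : M.Ob),
          tensorInr N a ≫ (BraidedCategory.braiding M N).hom = tensorInl N a) ∧
        -- which is closed, with the internal Hom as right adjoint of the tensor product
        ∃ adj : ∀ N : Multicategory.{u}, MonoidalCategory.tensorRight N ⊣ ihomFunctor N,
          (∀ (M N P : Multicategory.{u}) (F : tensorObj M N ⟶ P),
            (adj N).homEquiv M P F = curry F) ∧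
          ∃ closed : MonoidalClosed Multicategory.{u},
            ∀ N : Multicategory.{u}, closed.closed N =
              ⟨ihomFunctor N, (adj N).ofNatIsoLeft
                (BraidedCategory.tensorLeftIsoTensorRight N).symm⟩ := by
  refine ⟨fun M N P f => ⟨f.lift, postcomp_lift f, fun F h => ?_⟩, fun M N P => inferInstance,
    fun _ _ _ _ _ _ _ _ _ => rfl, assocIso, leftUnit, rightUnit, isMonoidal_multStruct,
    fun _ _ _ _ _ => rfl, fun _ _ _ _ _ => rfl, fun _ _ _ _ _ => rfl, fun _ => rfl,
    fun _ => rfl, inferInstance, fun _ _ _ => rfl, fun _ _ _ => rfl, tensorHomAdj,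
    fun _ _ _ F => ?_, ⟨fun N => ⟨ihomFunctor N, _⟩⟩, fun N => rfl⟩
  · subst h
    exact (lift_postcomp F).symm
  · rw [tensorHomAdj, Adjunction.mkOfHomEquiv_homEquiv]
    rfl
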